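/- Let $u_0, g_0, g_1 \in \mathcal S([0,\infty))$ be complex-valued (initial data $u(x,0)$, and boundary values $u(0,t)$, $u_x(0,t)$, for the derivative nonlinear Schrödinger equation $iu_t+u_{xx}=i(|u|^2u)_x$ on the half-line). Put $\Delta_1(t)=\frac34|g_0|^4-\frac i2(\bar g_1g_0-\bar g_0g_1)\in\mathbb R$, $p(x)=\frac12\int_0^x|u_0|^2$, $q(t)=\int_0^t\Delta_1$, $$U(x,k)=\begin{pmatrix}-\frac i2|u_0|^2 & ku_0e^{-2ip}\\ k\bar u_0e^{2ip}&\frac i2|u_0|^2\end{pmatrix},\qquad V(t,k)=\begin{pmatrix} V_{11} & (2k^3g_0+ikg_1+k|g_0|^2g_0)e^{-2iq}\\ (2k^3\bar g_0-ik\bar g_1+k|g_0|^2\bar g_0)e^{2iq}&-V_{11}\end{pmatrix},$$ $V_{11}=-ik^2|g_0|^2-\frac{3i}4|g_0|^4-\frac12(\bar g_1g_0-\bar g_0g_1)$. Let $\binom{b(k)}{a(k)}$ ($\operatorname{Im}k^2\ge0$) and $\binom{B(k)}{A(k)}$ ($\operatorname{Im}k^4\ge0$) be the values at $x=0$ and $t=0$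 of the second columns of the solutions, bounded and continuous on $[0,\infty)$, of $$X(x)=I+\int_\infty^x e^{ik^2(x'-x)\hat\sigma_3}(UX)(x')\,dx',\qquad T(t)=I+\int_\infty^t e^{2ik^4(t'-t)\hat\sigma_3}(VT)(t')\,dt',$$ where $\sigma_3=\operatorname{diag}(1,-1)$ and $e^{\hat\sigma_3}M=e^{\sigma_3}Me^{-\sigma_3}$. Write $f^*(k)=\overline{f(\bar k)}$, $c=bA-Ba$, $d=aA^*-bB^*$, and for $\lambda=k^2<0$ $$r(\lambda)=\frac{b^*(k)}{ka(k)}-\frac{B^*(k)}{ka(k)d(k)} .$$ For $\zeta\ge0$, with $\lambda_0=-\zeta/4$, let $\nu(\zeta)=\frac1{2\pi}\ln(1-\lambda_0|r(\lambda_0)|^2)$ (so $\nu(0)=0$), and for $x,t>0$, with $\zeta=x/t$, let $$u_a(x,t)=\sqrt{\frac{\nu(\zeta)}{2|\lambda_0|}}\,e^{i\alpha(\zeta,t)},$$ $$\alpha=\tfrac\pi4-\arg r(\lambda_0)-\arg\Gamma(i\nu)+\nu\ln(8t)+\tfrac1\pi\int_{-\infty}^{\lambda_0}\ln(\lambda_0-s)\,d\ln(1-s|r(s)|^2)+4t\lambda_0^2+\tfrac1\pi\int_0^{|\lambda_0|}\tfrac{\ln(1+s|r(-s)|^2)}s\,ds+2\int_0^t\Delta_1\,dt'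 .$$ (When $\nu(\zeta)=0$, i.e. $r(\lambda_0)=0$, we set $u_a=0$.) Assume that $a$ has no zeros in $\{\operatorname{Im}k^2\ge0\}$ and $d$ has no zeros in $\{\operatorname{Re}k^2\le0\le\operatorname{Im}k^2\}$. Then: 1. $|d(k)|^2=1+|c(k)|^2$ for $k\in\mathbb R$. 2. $r$ extends to a $C^\infty$ function on $(-\infty,0]$ and $k\,r(k^2)=\overline{c(\bar k)}/d(k)$ for all $k\in i\mathbb R$. 3. If moreover the global relation $B(k)a(k)-A(k)b(k)=0$ holds for all $k$ with $\operatorname{Re}k^2\ge0$, $\operatorname{Im}k^2\ge0$, then $r$ vanishes to all orders at $\lambda=0$, i.e. $r^{(j)}(0)=0$ for all $j\ge0$; $\nu$ is $C^\infty$ on $[0,\infty)$ and vanishes to all orders at $\zeta=0$; and $u_a(x,t)=O(|x/t|^n)$ as $x/t\to0$ for every $n\ge 0$, that is, for every $n$ there are $C,\delta>0$ with $|u_a(x,t)|\le C|x/t|^n$ for all $x,t>0$ with $x/t<\delta$. -/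

import Mathlib

open Set
open scoped ContDiff ComplexConjugate

namespace DNLS

/-- The Schwartz class on `[0, ∞)`: smooth up to the endpoint (one-sided derivatives at `0`), all
derivatives rapidly decreasing. Values on `(-∞, 0)` are irrelevant. -/
def IsSchwartzHalfLine (f : ℝ → ℂ) : Prop :=
  ContDiffOn ℝ ∞ f (Ici 0) ∧
    ∀ m n : ℕ, ∃ C : ℝ, ∀ x : ℝ, 0 ≤ x → x ^ m * ‖iteratedDerivWithin n f (Ici 0) x‖ ≤ C

/-- `∫_{(0,0)}^{(x,0)} Δ = ½ ∫₀ˣ |u₀|²`. -/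
noncomputable def initialPhase (u₀ : ℝ → ℂ) (x : ℝ) : ℝ :=
  1 / 2 * ∫ y in (0 : ℝ)..x, ‖u₀ y‖ ^ 2

/-- The `dt`-coefficient of `Δ` on `x = 0`: `¾|g₀|⁴ - (i/2)(ḡ₁ g₀ - ḡ₀ g₁)`
(the complex expression has zero imaginary part). -/
noncomputable def boundaryForm (g₀ g₁ : ℝ → ℂ) (t : ℝ) : ℝ :=
  ((3 / 4 : ℂ) * (‖g₀ t‖ : ℂ) ^ 4
    - Complex.I / 2 * (conj (g₁ t) * g₀ t - conj (g₀ t) * g₁ t)).re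

/-- `∫_{(0,0)}^{(0,t)} Δ`. -/
noncomputable def boundaryPhase (g₀ g₁ : ℝ → ℂ) (t : ℝ) : ℝ :=
  ∫ s in (0 : ℝ)..t, boundaryForm g₀ g₁ s

/-- The matrix `U(x, 0, k)` of the `x`-part of the Lax pair at `t = 0`. -/
noncomputable def laxU (u₀ : ℝ → ℂ) (k : ℂ) (x : ℝ) : Matrix (Fin 2) (Fin 2) ℂ :=
  !![-(Complex.I / 2) * (‖u₀ x‖ : ℂ) ^ 2,
      k * u₀ x * Complex.exp (-2 * Complex.I * (initialPhase u₀ x : ℂ));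
    k * conj (u₀ x) * Complex.exp (2 * Complex.I * (initialPhase u₀ x : ℂ)),
      (Complex.I / 2) * (‖u₀ x‖ : ℂ) ^ 2]

/-- The matrix `V(0, t, k)` of the `t`-part of the Lax pair at `x = 0`
(with `u = g₀` and `u_x = g₁`). -/
noncomputable def laxV (g₀ g₁ : ℝ → ℂ) (k : ℂ) (t : ℝ) : Matrix (Fin 2) (Fin 2) ℂ :=
  !![-Complex.I * k ^ 2 * (‖g₀ t‖ : ℂ) ^ 2 - 3 * Complex.I / 4 * (‖g₀ t‖ : ℂ) ^ 4
        - 1 / 2 * (conj (g₁ t) * g₀ t - conj (g₀ t) * g₁ t),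
      (2 * k ^ 3 * g₀ t + Complex.I * k * g₁ t + k * (‖g₀ t‖ : ℂ) ^ 2 * g₀ t)
        * Complex.exp (-2 * Complex.I * (boundaryPhase g₀ g₁ t : ℂ));
    (2 * k ^ 3 * conj (g₀ t) - Complex.I * k * conj (g₁ t)
          + k * (‖g₀ t‖ : ℂ) ^ 2 * conj (g₀ t))
        * Complex.exp (2 * Complex.I * (boundaryPhase g₀ g₁ t : ℂ)),
      Complex.I * k ^ 2 * (‖g₀ t‖ : ℂ) ^ 2 + 3 * Complex.I / 4 * (‖g₀ t‖ : ℂ) ^ 4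
        + 1 / 2 * (conj (g₁ t) * g₀ t - conj (g₀ t) * g₁ t)]

/-- `ψ` is the second column of the solution `X` of the Volterra equation
`X(x) = I + ∫_∞^x e^{iθ(y - x)σ̂₃} (W(y) X(y)) dy` on `[0, ∞)`. On the second column the operator
`e^{iθ(y - x)σ̂₃}` multiplies the first entry by `e^{2iθ(y - x)}` and fixes the second one.
For `W` integrable and `Im θ ≥ 0` there is exactly one bounded continuous solution. -/
structure IsVolterraColumn (θ : ℂ) (W : ℝ → Matrix (Fin 2) (Fin 2) ℂ)
    (ψ : ℝ → Fin 2 → ℂ) : Prop where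
  continuousOn : ContinuousOn ψ (Ici 0)
  bounded : ∃ C : ℝ, ∀ x : ℝ, 0 ≤ x → ‖ψ x‖ ≤ C
  first : ∀ x : ℝ, 0 ≤ x → ψ x 0 =
    -∫ y in Ioi x, Complex.exp (2 * Complex.I * θ * ((y - x : ℝ) : ℂ)) * (W y).mulVec (ψ y) 0
  second : ∀ x : ℝ, 0 ≤ x → ψ x 1 = 1 - ∫ y in Ioi x, (W y).mulVec (ψ y) 1

/-- The value at `0` of the second column of the solution of the Volterra equation. -/
noncomputable def volterraValue (θ : ℂ) (W : ℝ → Matrix (Fin 2) (Fin 2) ℂ) : Fin 2 → ℂ :=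
  Classical.epsilon (IsVolterraColumn θ W) 0

/-- The spectral function `a(k)`, `Im k² ≥ 0`: the `(2,2)` entry of `X(0,k)`. -/
noncomputable def specA0 (u₀ : ℝ → ℂ) (k : ℂ) : ℂ := volterraValue (k ^ 2) (laxU u₀ k) 1

/-- The spectral function `b(k)`, `Im k² ≥ 0`: the `(1,2)` entry of `X(0,k)`. -/
noncomputable def specB0 (u₀ : ℝ → ℂ) (k : ℂ) : ℂ := volterraValue (k ^ 2) (laxU u₀ k) 0

/-- The spectral function `A(k)`, `Im k⁴ ≥ 0`: the `(2,2)` entry of `T(0,k)`. -/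
noncomputable def specA (g₀ g₁ : ℝ → ℂ) (k : ℂ) : ℂ :=
  volterraValue (2 * k ^ 4) (laxV g₀ g₁ k) 1

/-- The spectral function `B(k)`, `Im k⁴ ≥ 0`: the `(1,2)` entry of `T(0,k)`. -/
noncomputable def specB (g₀ g₁ : ℝ → ℂ) (k : ℂ) : ℂ :=
  volterraValue (2 * k ^ 4) (laxV g₀ g₁ k) 0

/-- The Schwarz conjugate `f*(k) = conj (f (conj k))`. -/
noncomputable def schwarzConj (f : ℂ → ℂ) (k : ℂ) : ℂ := conj (f (conj k))

/-- `c = b A - B a`. -/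
noncomputable def specC (u₀ g₀ g₁ : ℝ → ℂ) (k : ℂ) : ℂ :=
  specB0 u₀ k * specA g₀ g₁ k - specB g₀ g₁ k * specA0 u₀ k

/-- `d = a A* - b B*`. -/
noncomputable def specD (u₀ g₀ g₁ : ℝ → ℂ) (k : ℂ) : ℂ :=
  specA0 u₀ k * schwarzConj (specA g₀ g₁) k - specB0 u₀ k * schwarzConj (specB g₀ g₁) k

/-- The global relation `B a - A b = 0` on `{k | arg k² ∈ [0, π/2]} ∪ {0}`. -/
def GlobalRelation (u₀ g₀ g₁ : ℝ → ℂ) : Prop :=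
  ∀ k : ℂ, 0 ≤ (k ^ 2).re → 0 ≤ (k ^ 2).im →
    specB g₀ g₁ k * specA0 u₀ k - specA g₀ g₁ k * specB0 u₀ k = 0

/-- The spectral function `r(l) = b*(k) / (k a(k)) - B*(k) / (k a(k) d(k))`, `k² = l < 0`, where
`k` is the root on the positive imaginary axis (either root gives the same value).
Only the values at `l < 0` are meaningful. -/
noncomputable def specR (u₀ g₀ g₁ : ℝ → ℂ) (l : ℝ) : ℂ :=
  let k : ℂ := (Real.sqrt (-l) : ℂ) * Complex.I
  schwarzConj (specB0 u₀) k / (k * specA0 u₀ k)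
    - schwarzConj (specB g₀ g₁) k / (k * specA0 u₀ k * specD u₀ g₀ g₁ k)

/-- `ν(ζ) = (1/2π) ln (1 - λ₀ |r(λ₀)|²)`, `λ₀ = -ζ/4`, for `ζ ≥ 0`. -/
noncomputable def nu (u₀ g₀ g₁ : ℝ → ℂ) (ζ : ℝ) : ℝ :=
  1 / (2 * Real.pi) * Real.log (1 - (-ζ / 4) * ‖specR u₀ g₀ g₁ (-ζ / 4)‖ ^ 2)

/-- The phase `α(ζ, t)`, for `ζ > 0`, `t > 0`. The Stieltjes integral against
`d ln (1 - s |r(s)|²)` is written with the derivative of this function. -/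
noncomputable def alpha (u₀ g₀ g₁ : ℝ → ℂ) (ζ t : ℝ) : ℝ :=
  let l₀ : ℝ := -ζ / 4
  let r : ℝ → ℂ := specR u₀ g₀ g₁
  Real.pi / 4 - Complex.arg (r l₀)
    - Complex.arg (Complex.Gamma (Complex.I * (nu u₀ g₀ g₁ ζ : ℂ)))
    + nu u₀ g₀ g₁ ζ * Real.log (8 * t)
    + 1 / Real.pi * (∫ s in Iio l₀,
        Real.log (l₀ - s) * deriv (fun s' : ℝ => Real.log (1 - s' * ‖r s'‖ ^ 2)) s)
    + 4 * t * l₀ ^ 2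
    + 1 / Real.pi * (∫ s in (0 : ℝ)..|l₀|, Real.log (1 + s * ‖r (-s)‖ ^ 2) / s)
    + 2 * ∫ s in (0 : ℝ)..t, boundaryForm g₀ g₁ s

/-- The leading coefficient `u_a(x,t) = √(ν(ζ) / (2|λ₀|)) e^{iα(ζ,t)}`, `ζ = x/t`, `λ₀ = -ζ/4`,
for `x > 0`, `t > 0`. -/
noncomputable def uA (u₀ g₀ g₁ : ℝ → ℂ) (x t : ℝ) : ℂ :=
  (Real.sqrt (nu u₀ g₀ g₁ (x / t) / (2 * |-(x / t) / 4|)) : ℂ)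
    * Complex.exp (Complex.I * (alpha u₀ g₀ g₁ (x / t) t : ℂ))

end DNLS

namespace DNLS

open MeasureTheory Filter Topology
open scoped BoundedContinuousFunction

/-! The apparent singularity of `r` at `λ = 0` comes only from working in `k`. For real `l = k²` the
phase `θ` is real, so the oscillating exponential can be moved from the kernel into the off-diagonal
coefficients without losing boundedness. Rescaling the first component by `k` then leaves a system
depending on `l` alone. Its solution is smooth in `l` on all of `ℝ`: the coefficients are smooth in
sup norm because the data decay rapidly, and inverting `1 + K` for a Volterra operator `K` is a
smooth operation (`contDiff_volterraSol`). Hence `a = α(l)`, `b = k β(l)`, and likewise for `A`, `B`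
(`exists_smooth_spectral`), with the conservation law `|α|² - l|β|² = 1`.

Algebra then gives `c = k γ(l)`, `d = δ(l)`, `|δ|² - l|γ|² = 1` and `r = γ̄/δ`
(`exists_smooth_reflection`). The quotient is smooth across `0`, since `δ` has no zeros: for `l ≥ 0`
by the conservation law, for `l < 0` by the hypothesis on `d`. The global relation says `γ = 0` for
`l > 0`, so `γ̄/δ` is a smooth function on `ℝ` vanishing on a half-line, and is therefore flat at
`0`. Flatness of `ν` follows the same way, and decay of `u_a` from the pointwise bound of `|u_a|` by
`|r(λ₀)|`. -/

theorem contDiff_ringInverse_comp {R : Type*} [NormedRing R] [NormedAlgebra ℝ R]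
    [CompleteSpace R] {f : ℝ → R} (hf : ContDiff ℝ ∞ f) (hu : ∀ l, IsUnit (f l)) :
    ContDiff ℝ ∞ fun l => Ring.inverse (f l) := by
  rw [contDiff_iff_contDiffAt]
  intro l
  obtain ⟨u, hu⟩ := hu l
  have h := contDiffAt_ringInverse ℝ (n := ∞) u
  rw [hu] at h
  exact h.comp l hf.contDiffAt

/-! ### Volterra equations on bounded continuous functions -/

section VolterraOperator

variable {V : Type*} [NormedAddCommGroup V] [NormedSpace ℝ V]

/-- Splitting off the fixed integrable weight `1/(1+y²)` lets the coefficients range over a Banach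
space of bounded functions, where smoothness in a parameter makes sense. -/
theorem integrable_weight_smul (m : ℝ →ᵇ (V →L[ℝ] V)) (f : ℝ →ᵇ V) :
    Integrable fun y : ℝ => (1 + y ^ 2)⁻¹ • m y (f y) := by
  refine (integrable_inv_one_add_sq.mul_const (‖m‖ * ‖f‖)).mono' ?_ ?_
  · refine Continuous.aestronglyMeasurable ?_
    refine Continuous.smul ?_ (m.continuous.clm_apply f.continuous)
    exact (by fun_prop : Continuous fun y : ℝ => 1 + y ^ 2).inv₀ fun y => by positivity
  · refine ae_of_all _ fun y => ?_
    rw [norm_smul, Real.norm_of_nonneg (by positivity)]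
    gcongr
    exact ((m y).le_opNorm _).trans
      (mul_le_mul (m.norm_coe_le_norm y) (f.norm_coe_le_norm y) (norm_nonneg _) (by positivity))

theorem continuous_weight_smul (m : ℝ →ᵇ (V →L[ℝ] V)) (f : ℝ →ᵇ V) :
    Continuous fun y : ℝ => (1 + y ^ 2)⁻¹ • m y (f y) :=
  ((by fun_prop : Continuous fun y : ℝ => 1 + y ^ 2).inv₀ fun y => by positivity).smul
    (m.continuous.clm_apply f.continuous)

/-- The function `x ↦ ∫ y in x⁺..∞, m(y) f(y) / (1 + y²)`, where `x⁺ = max x 0`. -/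
noncomputable def tailIntegral (m : ℝ →ᵇ (V →L[ℝ] V)) (f : ℝ →ᵇ V) (x : ℝ) : V :=
  ∫ y in Ioi (max x 0), (1 + y ^ 2)⁻¹ • m y (f y)

theorem tailIntegral_eq (m : ℝ →ᵇ (V →L[ℝ] V)) (f : ℝ →ᵇ V) (x : ℝ) :
    tailIntegral m f x = (∫ y in Ioi 0, (1 + y ^ 2)⁻¹ • m y (f y))
      - ∫ y in (0 : ℝ)..max x 0, (1 + y ^ 2)⁻¹ • m y (f y) := by
  have h := integrable_weight_smul m f
  rw [eq_sub_iff_add_eq, add_comm]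
  exact intervalIntegral.integral_interval_add_Ioi h.integrableOn h.integrableOn

/-- The tail of the integral of `1 / (1 + y²)`. -/
noncomputable def arctanTail (x : ℝ) : ℝ := Real.pi / 2 - Real.arctan x

theorem arctanTail_nonneg (x : ℝ) : 0 ≤ arctanTail x :=
  sub_nonneg.2 (Real.arctan_lt_pi_div_two x).le

theorem arctanTail_le {x : ℝ} (hx : 0 ≤ x) : arctanTail x ≤ Real.pi / 2 :=
  sub_le_self _ (Real.arctan_nonneg.2 hx)

/-- The derivative of `arctanTail` is minus the weight, so the integrand has an explicit
antiderivative. The factor `1/(n+1)` builds up the factorial in the iterates. -/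
theorem integral_Ioi_arctanTail_pow (n : ℕ) (x : ℝ) :
    IntegrableOn (fun y : ℝ => (1 + y ^ 2)⁻¹ * arctanTail y ^ n) (Ioi x) ∧
      ∫ y in Ioi x, (1 + y ^ 2)⁻¹ * arctanTail y ^ n = arctanTail x ^ (n + 1) / (n + 1) := by
  have hd : ∀ y : ℝ, HasDerivAt (fun y => -(arctanTail y ^ (n + 1) / (n + 1)))
      ((1 + y ^ 2)⁻¹ * arctanTail y ^ n) y := by
    intro y
    have h1 : HasDerivAt arctanTail (-(1 / (1 + y ^ 2))) y :=
      (Real.hasDerivAt_arctan y).const_sub _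
    have h2 := ((h1.pow (n + 1)).div_const ((n : ℝ) + 1)).neg
    refine h2.congr_deriv ?_
    have : (n : ℝ) + 1 ≠ 0 := by positivity
    push_cast
    field_simp
  have ht : Tendsto (fun y => -(arctanTail y ^ (n + 1) / (n + 1))) atTop (𝓝 0) := by
    have h1 : Tendsto arctanTail atTop (𝓝 0) := by
      have := (Real.tendsto_arctan_atTop.mono_right nhdsWithin_le_nhds).const_sub (Real.pi / 2)
      rw [sub_self] at this
      exact this
    have h2 := ((h1.pow (n + 1)).div_const ((n : ℝ) + 1)).neg
    simpa using h2
  have hp : ∀ y ∈ Ioi x, 0 ≤ (1 + y ^ 2)⁻¹ * arctanTail y ^ n := fun y _ =>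
    mul_nonneg (by positivity) (pow_nonneg (arctanTail_nonneg y) n)
  refine ⟨integrableOn_Ioi_deriv_of_nonneg' (fun y _ => hd y) hp ht, ?_⟩
  rw [integral_Ioi_of_hasDerivAt_of_nonneg' (fun y _ => hd y) hp ht]
  ring

theorem norm_tailIntegral_le (m : ℝ →ᵇ (V →L[ℝ] V)) (f : ℝ →ᵇ V) {C : ℝ} (n : ℕ)
    (hf : ∀ x, ‖f x‖ ≤ C * arctanTail (max x 0) ^ n) (x : ℝ) :
    ‖tailIntegral m f x‖ ≤ ‖m‖ * C / (n + 1) * arctanTail (max x 0) ^ (n + 1) := by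
  obtain ⟨hi, he⟩ := integral_Ioi_arctanTail_pow n (max x 0)
  calc ‖tailIntegral m f x‖
      ≤ ∫ y in Ioi (max x 0), ‖m‖ * C * ((1 + y ^ 2)⁻¹ * arctanTail y ^ n) := by
        refine norm_integral_le_of_norm_le (hi.const_mul _) ?_
        refine (ae_restrict_iff' measurableSet_Ioi).2 (ae_of_all _ fun y hy => ?_)
        have hy0 : max y 0 = y := max_eq_left ((le_max_right x 0).trans hy.le)
        rw [norm_smul, Real.norm_of_nonneg (by positivity)]
        calc (1 + y ^ 2)⁻¹ * ‖m y (f y)‖ ≤ (1 + y ^ 2)⁻¹ * (‖m‖ * (C * arctanTail y ^ n)) := by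
              gcongr
              refine ((m y).le_opNorm _).trans ?_
              have := hf y
              rw [hy0] at this
              exact mul_le_mul (m.norm_coe_le_norm y) this (norm_nonneg _) (by positivity)
          _ = _ := by ring
    _ = _ := by rw [integral_const_mul, he]; ring

theorem norm_tailIntegral_le' (m : ℝ →ᵇ (V →L[ℝ] V)) (f : ℝ →ᵇ V) (x : ℝ) :
    ‖tailIntegral m f x‖ ≤ Real.pi / 2 * ‖m‖ * ‖f‖ := by
  have h := norm_tailIntegral_le m f (C := ‖f‖) 0 (fun x => by simpa using f.norm_coe_le_norm x) x
  have h2 := arctanTail_le (le_max_right x 0)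
  calc _ ≤ _ := h
    _ = ‖m‖ * ‖f‖ * arctanTail (max x 0) := by simp
    _ ≤ ‖m‖ * ‖f‖ * (Real.pi / 2) := by gcongr
    _ = _ := by ring

theorem continuous_tailIntegral (m : ℝ →ᵇ (V →L[ℝ] V)) (f : ℝ →ᵇ V) :
    Continuous (tailIntegral m f) := by
  rw [funext (tailIntegral_eq m f)]
  refine continuous_const.sub ?_
  exact (intervalIntegral.continuous_primitive
    (fun a b => (integrable_weight_smul m f).intervalIntegrable) 0).comp
    (continuous_id.max continuous_const)

/-- `f ↦ ∫ y in x⁺..∞, m(y) f(y) / (1 + y²)`, as a bilinear map. -/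
noncomputable def volterraBilin :
    (ℝ →ᵇ (V →L[ℝ] V)) →ₗ[ℝ] (ℝ →ᵇ V) →ₗ[ℝ] (ℝ →ᵇ V) :=
  LinearMap.mk₂ ℝ
    (fun m f => BoundedContinuousFunction.ofNormedAddCommGroup (tailIntegral m f)
      (continuous_tailIntegral m f) _ (norm_tailIntegral_le' m f))
    (fun m m' f => by
      ext1 x
      simp only [BoundedContinuousFunction.coe_ofNormedAddCommGroup, tailIntegral,
        BoundedContinuousFunction.coe_add, Pi.add_apply, add_apply, smul_add]
      exact integral_add (integrable_weight_smul m f).integrableOn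
        (integrable_weight_smul m' f).integrableOn)
    (fun c m f => by
      ext1 x
      simp only [BoundedContinuousFunction.coe_ofNormedAddCommGroup, tailIntegral,
        BoundedContinuousFunction.coe_smul, smul_apply]
      simp_rw [smul_comm _ c]
      exact integral_smul c _)
    (fun m f f' => by
      ext1 x
      simp only [BoundedContinuousFunction.coe_ofNormedAddCommGroup, tailIntegral,
        BoundedContinuousFunction.coe_add, Pi.add_apply, map_add, smul_add]
      exact integral_add (integrable_weight_smul m f).integrableOn
        (integrable_weight_smul m f').integrableOn)
    (fun c m f => by
      ext1 x
      simp only [BoundedContinuousFunction.coe_ofNormedAddCommGroup, tailIntegral,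
        BoundedContinuousFunction.coe_smul, map_smul]
      simp_rw [smul_comm _ c]
      exact integral_smul c _)

theorem norm_volterraBilin_le (m : ℝ →ᵇ (V →L[ℝ] V)) (f : ℝ →ᵇ V) :
    ‖volterraBilin m f‖ ≤ Real.pi / 2 * ‖m‖ * ‖f‖ :=
  BoundedContinuousFunction.norm_ofNormedAddCommGroup_le _
    (by positivity) (norm_tailIntegral_le' m f)

/-- The Volterra operator `f ↦ ∫ y in x⁺..∞, m(y) f(y) / (1 + y²)`, as a bounded bilinear map. -/
noncomputable def volterraOp :
    (ℝ →ᵇ (V →L[ℝ] V)) →L[ℝ] (ℝ →ᵇ V) →L[ℝ] (ℝ →ᵇ V) :=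
  LinearMap.mkContinuous₂ (E := ℝ →ᵇ (V →L[ℝ] V)) (F := ℝ →ᵇ V) (G := ℝ →ᵇ V)
    (σ₁₃ := RingHom.id ℝ) (σ₂₃ := RingHom.id ℝ) volterraBilin (Real.pi / 2) norm_volterraBilin_le

theorem volterraOp_apply (m : ℝ →ᵇ (V →L[ℝ] V)) (f : ℝ →ᵇ V) (x : ℝ) :
    volterraOp m f x = tailIntegral m f x := rfl

theorem norm_volterraOp_pow_apply_le (m : ℝ →ᵇ (V →L[ℝ] V)) (f : ℝ →ᵇ V) (n : ℕ) (x : ℝ) :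
    ‖((volterraOp m) ^ n) f x‖
      ≤ ‖m‖ ^ n / n.factorial * ‖f‖ * arctanTail (max x 0) ^ n := by
  induction n generalizing x with
  | zero => simpa using f.norm_coe_le_norm x
  | succ n ih =>
    rw [pow_succ', mul_apply_eq_comp, volterraOp_apply]
    refine (norm_tailIntegral_le m _ n ih x).trans_eq ?_
    rw [Nat.factorial_succ]
    push_cast
    field_simp
    ring

/-- No smallness of `m` is needed: `‖Kⁿ‖` is at most `(‖m‖π/2)ⁿ/n!`, so some `1 - Kⁿ` is a unit, and
`1 - K` is a commuting factor of it. -/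
theorem isUnit_one_sub_volterraOp [CompleteSpace V] (m : ℝ →ᵇ (V →L[ℝ] V)) :
    IsUnit (1 - volterraOp m) := by
  set K := volterraOp m with hK
  have hb : ∀ n : ℕ, ‖K ^ n‖ ≤ (‖m‖ * (Real.pi / 2)) ^ n / n.factorial := by
    intro n
    refine ContinuousLinearMap.opNorm_le_bound _ (by positivity) fun f => ?_
    refine (BoundedContinuousFunction.norm_le (by positivity)).2 fun x => ?_
    refine (norm_volterraOp_pow_apply_le m f n x).trans ?_
    have h2 := arctanTail_le (le_max_right x 0)
    have h3 := arctanTail_nonneg (max x 0)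
    calc _ ≤ ‖m‖ ^ n / n.factorial * ‖f‖ * (Real.pi / 2) ^ n := by gcongr
      _ = _ := by rw [mul_pow]; ring
  obtain ⟨n, hn⟩ := ((FloorSemiring.tendsto_pow_div_factorial_atTop
    (‖m‖ * (Real.pi / 2))).eventually_lt_const one_pos).exists
  have hu : IsUnit (1 - K ^ n) := isUnit_one_sub_of_norm_lt_one ((hb n).trans_lt hn)
  have hc : Commute (1 - K) (∑ i ∈ Finset.range n, K ^ i) :=
    Commute.sum_right _ _ _ fun i _ =>
      ((Commute.one_left _).sub_left (Commute.refl _)).pow_right i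
  rw [← mul_neg_geom_sum] at hu
  exact (hc.isUnit_mul_iff.1 hu).1

theorem isUnit_one_add_volterraOp [CompleteSpace V] (m : ℝ →ᵇ (V →L[ℝ] V)) :
    IsUnit (1 + volterraOp m) := by
  have h := isUnit_one_sub_volterraOp (-m)
  have e : volterraOp (-m) = -volterraOp m := ContinuousLinearMap.map_neg volterraOp m
  rwa [e, sub_neg_eq_add] at h

/-- The solution of the Volterra equation `f(x) = v - ∫ y in x⁺..∞, m(y) f(y) / (1 + y²)`. -/
noncomputable def volterraSol (m : ℝ →ᵇ (V →L[ℝ] V)) (v : V) : ℝ →ᵇ V :=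
  Ring.inverse (1 + volterraOp m) (BoundedContinuousFunction.const ℝ v)

theorem volterraSol_apply [CompleteSpace V] (m : ℝ →ᵇ (V →L[ℝ] V)) (v : V) (x : ℝ) :
    volterraSol m v x = v - tailIntegral m (volterraSol m v) x := by
  have h := congrArg (fun T => T (BoundedContinuousFunction.const ℝ v) x)
    (Ring.mul_inverse_cancel _ (isUnit_one_add_volterraOp m))
  exact eq_sub_of_add_eq h

theorem eq_volterraSol [CompleteSpace V] (m : ℝ →ᵇ (V →L[ℝ] V)) (v : V) (f : ℝ →ᵇ V)
    (hf : ∀ x, f x = v - tailIntegral m f x) : f = volterraSol m v := by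
  have h1 : (1 + volterraOp m) f = BoundedContinuousFunction.const ℝ v := by
    ext1 x
    exact add_eq_of_eq_sub (hf x)
  have h := congrArg (fun T => T f) (Ring.inverse_mul_cancel _ (isUnit_one_add_volterraOp m))
  rw [volterraSol, ← h1]
  exact h.symm

/-- The operator is continuous linear in `m`, inversion is smooth at units, and evaluation at `x` is
continuous linear. -/
theorem contDiff_volterraSol [CompleteSpace V] {m : ℝ → ℝ →ᵇ (V →L[ℝ] V)} (hm : ContDiff ℝ ∞ m)
    (v : V) (x : ℝ) : ContDiff ℝ ∞ fun l => volterraSol (m l) v x := by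
  have hc : ContDiff ℝ ∞ fun m : ℝ →ᵇ (V →L[ℝ] V) => volterraOp m :=
    ContinuousLinearMap.contDiff (𝕜 := ℝ) (E := ℝ →ᵇ (V →L[ℝ] V))
      (F := (ℝ →ᵇ V) →L[ℝ] (ℝ →ᵇ V)) volterraOp
  have h0 : ContDiff ℝ ∞ fun l => 1 + volterraOp (m l) :=
    contDiff_const.add (hc.comp hm)
  have h1 := contDiff_ringInverse_comp h0 fun l => isUnit_one_add_volterraOp (m l)
  have h2 := h1.clm_apply (contDiff_const (c := BoundedContinuousFunction.const ℝ v))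
  exact (BoundedContinuousFunction.evalCLM ℝ x).contDiff.comp h2

end VolterraOperator


/-! ### Rapidly decreasing functions and smooth dependence on the frequency -/

/-- Continuous functions on `[0, ∞)` that decrease faster than any power. -/
structure RapidDecay (f : ℝ → ℂ) : Prop where
  continuousOn : ContinuousOn f (Ici 0)
  decay : ∀ m : ℕ, ∃ C : ℝ, ∀ x : ℝ, 0 ≤ x → x ^ m * ‖f x‖ ≤ C

theorem IsSchwartzHalfLine.rapidDecay {f : ℝ → ℂ} (hf : IsSchwartzHalfLine f) : RapidDecay f :=
  ⟨hf.1.continuousOn, fun m => by simpa using hf.2 m 0⟩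

namespace RapidDecay

variable {f g : ℝ → ℂ}

theorem bounded (hf : RapidDecay f) : ∃ C : ℝ, ∀ x : ℝ, 0 ≤ x → ‖f x‖ ≤ C := by
  simpa using hf.decay 0

theorem add (hf : RapidDecay f) (hg : RapidDecay g) : RapidDecay fun x => f x + g x := by
  refine ⟨hf.continuousOn.add hg.continuousOn, fun m => ?_⟩
  obtain ⟨C, hC⟩ := hf.decay m
  obtain ⟨D, hD⟩ := hg.decay m
  refine ⟨C + D, fun x hx => ?_⟩
  calc _ ≤ x ^ m * (‖f x‖ + ‖g x‖) := by gcongr; exact norm_add_le _ _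
    _ ≤ _ := by rw [mul_add]; exact add_le_add (hC x hx) (hD x hx)

theorem mul_bounded (hf : RapidDecay f) (hg : ContinuousOn g (Ici 0)) {D : ℝ}
    (hD : ∀ x : ℝ, 0 ≤ x → ‖g x‖ ≤ D) : RapidDecay fun x => f x * g x := by
  refine ⟨hf.continuousOn.mul hg, fun m => ?_⟩
  obtain ⟨C, hC⟩ := hf.decay m
  have hC0 : 0 ≤ C := (by positivity : (0 : ℝ) ≤ 0 ^ m * ‖f 0‖).trans (hC 0 le_rfl)
  refine ⟨C * D, fun x hx => ?_⟩
  rw [norm_mul, ← mul_assoc]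
  exact mul_le_mul (hC x hx) (hD x hx) (norm_nonneg _) hC0

theorem mul (hf : RapidDecay f) (hg : RapidDecay g) : RapidDecay fun x => f x * g x :=
  let ⟨_, hC⟩ := hg.bounded
  hf.mul_bounded hg.continuousOn hC

theorem const_mul (hf : RapidDecay f) (c : ℂ) : RapidDecay fun x => c * f x := by
  simpa only [mul_comm] using
    hf.mul_bounded (g := fun _ => c) continuousOn_const (fun _ _ => le_rfl)

theorem conjugate (hf : RapidDecay f) : RapidDecay fun x => conj (f x) :=
  ⟨Complex.continuous_conj.comp_continuousOn hf.continuousOn, fun m => by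
    simpa using hf.decay m⟩

theorem id_mul (hf : RapidDecay f) : RapidDecay fun x => (x : ℂ) * f x := by
  refine ⟨Complex.continuous_ofReal.continuousOn.mul hf.continuousOn, fun m => ?_⟩
  obtain ⟨C, hC⟩ := hf.decay (m + 1)
  refine ⟨C, fun x hx => (Eq.le ?_).trans (hC x hx)⟩
  rw [norm_mul, Complex.norm_real, Real.norm_of_nonneg hx]
  ring

theorem weight_mul (hf : RapidDecay f) : RapidDecay fun x => (1 + (x : ℂ) ^ 2) * f x := by
  convert hf.add hf.id_mul.id_mul using 2 with x
  ring

theorem congr (hf : RapidDecay f) (h : ∀ x, g x = f x) : RapidDecay g :=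
  (funext h : g = f) ▸ hf

theorem norm_sq (hf : RapidDecay f) : RapidDecay fun x => (‖f x‖ : ℂ) ^ 2 :=
  (hf.mul hf.conjugate).congr fun _ => (Complex.mul_conj' _).symm

theorem norm_pow_four (hf : RapidDecay f) : RapidDecay fun x => (‖f x‖ : ℂ) ^ 4 :=
  (hf.norm_sq.mul hf.norm_sq).congr fun _ => by ring

theorem exp_mul_bound (hf : RapidDecay f) (l : ℝ) :
    ∃ C : ℝ, ∀ y : ℝ,
      ‖Complex.exp (Complex.I * (l * max y 0 : ℝ)) * f (max y 0)‖ ≤ C := by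
  obtain ⟨C, hC⟩ := hf.bounded
  refine ⟨C, fun y => ?_⟩
  rw [norm_mul, Complex.norm_exp_I_mul_ofReal, one_mul]
  exact hC _ (le_max_right _ _)

theorem continuous_comp_max (hf : ContinuousOn f (Ici 0)) : Continuous fun y : ℝ => f (max y 0) :=
  hf.comp_continuous (continuous_id.max continuous_const) fun y => le_max_right y 0

/-- The function `y ↦ e^{i l y⁺} f(y⁺)`, where `y⁺ = max y 0`. -/
noncomputable def osc (hf : RapidDecay f) (l : ℝ) : ℝ →ᵇ ℂ :=
  BoundedContinuousFunction.ofNormedAddCommGroup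
    (fun y : ℝ => Complex.exp (Complex.I * (l * max y 0 : ℝ)) * f (max y 0))
    ((by fun_prop : Continuous fun y : ℝ => Complex.exp (Complex.I * (l * max y 0 : ℝ))).mul
      (continuous_comp_max hf.continuousOn))
    _ (hf.exp_mul_bound l).choose_spec

theorem osc_apply (hf : RapidDecay f) (l y : ℝ) :
    hf.osc l y = Complex.exp (Complex.I * (l * max y 0 : ℝ)) * f (max y 0) := rfl

end RapidDecay

theorem norm_exp_I_mul_sub_one_sub_le (x : ℝ) :
    ‖Complex.exp (Complex.I * x) - 1 - Complex.I * x‖ ≤ 3 * x ^ 2 := by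
  have hn : ‖Complex.I * (x : ℂ)‖ = |x| := by simp
  rcases le_total |x| 1 with h | h
  · refine (Complex.norm_exp_sub_one_sub_id_le (hn.trans_le h)).trans ?_
    rw [hn, sq_abs]
    nlinarith [sq_nonneg x]
  -- For large `x` the trivial bound `2 + |x|` suffices; a bound on all of `ℝ` is needed because `h
  -- y` is unbounded in `y`.
  · calc _ ≤ ‖Complex.exp (Complex.I * x)‖ + ‖(1 : ℂ)‖ + ‖Complex.I * (x : ℂ)‖ :=
          (norm_sub_le _ _).trans (add_le_add_left (norm_sub_le _ _) _)
      _ = 2 + |x| := by rw [hn, Complex.norm_exp_I_mul_ofReal, norm_one]; ring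
      _ ≤ 3 * |x| ^ 2 := by nlinarith
      _ = _ := by rw [sq_abs]

namespace RapidDecay

variable {f g : ℝ → ℂ}

/-- The remainder at `y` is of size `h² y² |f(y)|`, uniformly `O(h²)` by the decay of `f`, so the
derivative exists in sup norm. -/
theorem hasDerivAt_osc (hf : RapidDecay f) (l : ℝ) :
    HasDerivAt hf.osc ((hf.id_mul.const_mul Complex.I).osc l) l := by
  rw [hasDerivAt_iff_isLittleO_nhds_zero]
  obtain ⟨C, hC⟩ := hf.decay 2
  have hC0 : 0 ≤ C := (by positivity : (0 : ℝ) ≤ 0 ^ 2 * ‖f 0‖).trans (hC 0 le_rfl)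
  have hO : (fun h => hf.osc (l + h) - hf.osc l - h • (hf.id_mul.const_mul Complex.I).osc l)
      =O[𝓝 0] fun h : ℝ => h ^ 2 := by
    refine Asymptotics.IsBigO.of_bound (3 * C) (Eventually.of_forall fun h => ?_)
    refine (BoundedContinuousFunction.norm_le (by positivity)).2 fun y => ?_
    set z := max y 0 with hz
    have hz0 : 0 ≤ z := le_max_right y 0
    have e : (hf.osc (l + h) - hf.osc l - h • (hf.id_mul.const_mul Complex.I).osc l) y
        = Complex.exp (Complex.I * (l * z : ℝ))
          * ((Complex.exp (Complex.I * (h * z : ℝ)) - 1 - Complex.I * (h * z : ℝ)) * f z) := by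
      simp only [BoundedContinuousFunction.coe_sub, BoundedContinuousFunction.coe_smul,
        Pi.sub_apply, osc_apply, ← hz, Complex.real_smul]
      rw [show Complex.I * (((l + h) * z : ℝ) : ℂ)
        = Complex.I * (l * z : ℝ) + Complex.I * (h * z : ℝ) by push_cast; ring, Complex.exp_add]
      push_cast
      ring
    rw [e, norm_mul, Complex.norm_exp_I_mul_ofReal, one_mul, norm_mul]
    calc _ ≤ 3 * (h * z) ^ 2 * ‖f z‖ := by
          gcongr; exact norm_exp_I_mul_sub_one_sub_le _
      _ = 3 * h ^ 2 * (z ^ 2 * ‖f z‖) := by ring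
      _ ≤ 3 * h ^ 2 * C := by gcongr; exact hC z hz0
      _ = _ := by rw [norm_pow, Real.norm_eq_abs, sq_abs]; ring
  refine hO.trans_isLittleO ?_
  exact Asymptotics.isLittleO_pow_id one_lt_two

/-- The derivative is again of the form `osc`, for `i x f(x)`; hence the induction is over all `f`
at once. -/
theorem contDiff_osc_nat (n : ℕ) : ∀ {f : ℝ → ℂ} (hf : RapidDecay f), ContDiff ℝ n hf.osc := by
  induction n with
  | zero =>
    intro f hf
    exact contDiff_zero.2
      (continuous_iff_continuousAt.2 fun l => (hf.hasDerivAt_osc l).continuousAt)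
  | succ n ih =>
    intro f hf
    have h : ContDiff ℝ ((n : WithTop ℕ∞) + 1) hf.osc := by
      rw [contDiff_succ_iff_deriv]
      refine ⟨fun l => (hf.hasDerivAt_osc l).differentiableAt, by simp, ?_⟩
      rw [funext fun l => (hf.hasDerivAt_osc l).deriv]
      exact ih _
    exact_mod_cast h

theorem contDiff_osc (hf : RapidDecay f) : ContDiff ℝ ∞ hf.osc :=
  contDiff_infty.2 fun n => contDiff_osc_nat n hf

end RapidDecay


/-! ### Removing the oscillating kernel and the factor `k` -/

/-- The matrix with the entry `c` at `(i, j)` and zeros elsewhere, as an operator on `ℂ²`. -/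
noncomputable def entryOp (i j : Fin 2) : ℂ →L[ℝ] (Fin 2 → ℂ) →L[ℝ] (Fin 2 → ℂ) :=
  (ContinuousLinearMap.compL ℝ (Fin 2 → ℂ) ℂ (Fin 2 → ℂ)
      (ContinuousLinearMap.single ℝ (fun _ : Fin 2 => ℂ) i)) ∘L
    ((ContinuousLinearMap.compL ℝ (Fin 2 → ℂ) ℂ ℂ).flip
      (ContinuousLinearMap.proj (R := ℝ) (φ := fun _ : Fin 2 => ℂ) j)) ∘L
    (ContinuousLinearMap.mul ℝ ℂ)

theorem entryOp_apply (i j : Fin 2) (c : ℂ) (v : Fin 2 → ℂ) :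
    entryOp i j c v = Pi.single i (c * v j) := by
  simp [entryOp]

/-- The operator-valued function with matrix `[[P, Q], [S, -P]]`. -/
noncomputable def coefficientOp (P Q S : ℝ →ᵇ ℂ) :
    ℝ →ᵇ ((Fin 2 → ℂ) →L[ℝ] (Fin 2 → ℂ)) :=
  (entryOp 0 0).compLeftContinuousBounded ℝ P + (entryOp 0 1).compLeftContinuousBounded ℝ Q
    + (entryOp 1 0).compLeftContinuousBounded ℝ S - (entryOp 1 1).compLeftContinuousBounded ℝ P

theorem coefficientOp_apply_zero (P Q S : ℝ →ᵇ ℂ) (y : ℝ) (v : Fin 2 → ℂ) :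
    coefficientOp P Q S y v 0 = P y * v 0 + Q y * v 1 := by
  simp [coefficientOp, entryOp_apply]

theorem coefficientOp_apply_one (P Q S : ℝ →ᵇ ℂ) (y : ℝ) (v : Fin 2 → ℂ) :
    coefficientOp P Q S y v 1 = S y * v 0 - P y * v 1 := by
  simp [coefficientOp, entryOp_apply, sub_eq_add_neg]

theorem contDiff_coefficientOp {P Q S : ℝ → ℝ →ᵇ ℂ} (hP : ContDiff ℝ ∞ P) (hQ : ContDiff ℝ ∞ Q)
    (hS : ContDiff ℝ ∞ S) : ContDiff ℝ ∞ fun l => coefficientOp (P l) (Q l) (S l) := by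
  have h : ∀ i j, ContDiff ℝ ∞
      fun g : ℝ →ᵇ ℂ => (entryOp i j).compLeftContinuousBounded ℝ g := fun i j =>
    ContinuousLinearMap.contDiff (𝕜 := ℝ) (E := ℝ →ᵇ ℂ)
      (F := ℝ →ᵇ ((Fin 2 → ℂ) →L[ℝ] (Fin 2 → ℂ))) ((entryOp i j).compLeftContinuousBounded ℝ)
  exact ((((h 0 0).comp hP).add ((h 0 1).comp hQ)).add ((h 1 0).comp hS)).sub ((h 1 1).comp hP)

/-- The equations satisfied by the second column after the oscillating factor has been moved from
the kernel to the off-diagonal coefficients `c₁ q`, `c₂ q̄`. -/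
structure IsGaugedColumn (θ : ℝ) (p q : ℝ → ℂ) (c₁ c₂ : ℂ) (f : ℝ →ᵇ (Fin 2 → ℂ)) : Prop where
  first : ∀ x : ℝ, f x 0 = -∫ y in Ioi (max x 0),
    (p y * f y 0 + c₁ * Complex.exp (2 * Complex.I * θ * y) * q y * f y 1)
  second : ∀ x : ℝ, f x 1 = 1 - ∫ y in Ioi (max x 0),
    (c₂ * Complex.exp (-(2 * Complex.I * θ * y)) * conj (q y) * f y 0 - p y * f y 1)

/-- The coefficients of the gauged equation. -/
noncomputable def gaugedOp (θ : ℝ) {p q : ℝ → ℂ} (hp : RapidDecay p) (hq : RapidDecay q)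
    (c₁ c₂ : ℂ) : ℝ →ᵇ ((Fin 2 → ℂ) →L[ℝ] (Fin 2 → ℂ)) :=
  coefficientOp (hp.weight_mul.osc 0) (c₁ • hq.weight_mul.osc (2 * θ))
    (c₂ • hq.conjugate.weight_mul.osc (-(2 * θ)))

/-- The factor `1 + y²` built into the coefficients by `weight_mul` cancels the weight of the tail
integral. -/
theorem gaugedOp_apply_zero (θ : ℝ) {p q : ℝ → ℂ} (hp : RapidDecay p) (hq : RapidDecay q)
    (c₁ c₂ : ℂ) {y : ℝ} (hy : 0 ≤ y) (v : Fin 2 → ℂ) :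
    ((1 + y ^ 2)⁻¹ • gaugedOp θ hp hq c₁ c₂ y v) 0
      = p y * v 0 + c₁ * Complex.exp (2 * Complex.I * θ * y) * q y * v 1 := by
  have h : (1 + (y : ℂ) ^ 2) ≠ 0 := by
    exact_mod_cast (by positivity : (1 + y ^ 2 : ℝ) ≠ 0)
  rw [Pi.smul_apply, gaugedOp, coefficientOp_apply_zero, Complex.real_smul]
  simp only [BoundedContinuousFunction.coe_smul, RapidDecay.osc_apply, max_eq_left hy, smul_eq_mul]
  rw [show Complex.I * ((2 * θ * y : ℝ) : ℂ) = 2 * Complex.I * θ * y by push_cast; ring]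
  push_cast
  simp only [zero_mul, mul_zero, Complex.exp_zero]
  field_simp

theorem gaugedOp_apply_one (θ : ℝ) {p q : ℝ → ℂ} (hp : RapidDecay p) (hq : RapidDecay q)
    (c₁ c₂ : ℂ) {y : ℝ} (hy : 0 ≤ y) (v : Fin 2 → ℂ) :
    ((1 + y ^ 2)⁻¹ • gaugedOp θ hp hq c₁ c₂ y v) 1
      = c₂ * Complex.exp (-(2 * Complex.I * θ * y)) * conj (q y) * v 0 - p y * v 1 := by
  have h : (1 + (y : ℂ) ^ 2) ≠ 0 := by
    exact_mod_cast (by positivity : (1 + y ^ 2 : ℝ) ≠ 0)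
  rw [Pi.smul_apply, gaugedOp, coefficientOp_apply_one, Complex.real_smul]
  simp only [BoundedContinuousFunction.coe_smul, RapidDecay.osc_apply, max_eq_left hy, smul_eq_mul]
  rw [show Complex.I * ((-(2 * θ) * y : ℝ) : ℂ) = -(2 * Complex.I * θ * y) by push_cast; ring]
  push_cast
  simp only [zero_mul, mul_zero, Complex.exp_zero]
  field_simp

theorem isGaugedColumn_iff (θ : ℝ) {p q : ℝ → ℂ} (hp : RapidDecay p) (hq : RapidDecay q)
    (c₁ c₂ : ℂ) (f : ℝ →ᵇ (Fin 2 → ℂ)) :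
    IsGaugedColumn θ p q c₁ c₂ f ↔ f = volterraSol (gaugedOp θ hp hq c₁ c₂) ![0, 1] := by
  have key : ∀ i x, tailIntegral (gaugedOp θ hp hq c₁ c₂) f x i =
      ∫ y in Ioi (max x 0), ((1 + y ^ 2)⁻¹ • gaugedOp θ hp hq c₁ c₂ y (f y)) i := fun i x =>
    eval_integral (f := fun y => (1 + y ^ 2)⁻¹ • gaugedOp θ hp hq c₁ c₂ y (f y))
      (fun j => (integrable_weight_smul (gaugedOp θ hp hq c₁ c₂) f).integrableOn.eval j) i
  have k0 : ∀ x, tailIntegral (gaugedOp θ hp hq c₁ c₂) f x 0 = ∫ y in Ioi (max x 0),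
      (p y * f y 0 + c₁ * Complex.exp (2 * Complex.I * θ * y) * q y * f y 1) := fun x =>
    (key 0 x).trans (setIntegral_congr_fun measurableSet_Ioi fun y hy =>
      gaugedOp_apply_zero θ hp hq c₁ c₂ ((le_max_right x 0).trans (le_of_lt hy)) (f y))
  have k1 : ∀ x, tailIntegral (gaugedOp θ hp hq c₁ c₂) f x 1 = ∫ y in Ioi (max x 0),
      (c₂ * Complex.exp (-(2 * Complex.I * θ * y)) * conj (q y) * f y 0 - p y * f y 1) := fun x =>
    (key 1 x).trans (setIntegral_congr_fun measurableSet_Ioi fun y hy =>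
      gaugedOp_apply_one θ hp hq c₁ c₂ ((le_max_right x 0).trans (le_of_lt hy)) (f y))
  constructor
  · intro h
    refine eq_volterraSol _ _ _ fun x => ?_
    ext i
    fin_cases i
    · simpa [k0] using h.first x
    · simpa [k1] using h.second x
  · intro h
    have hs : ∀ x, f x = ![0, 1] - tailIntegral (gaugedOp θ hp hq c₁ c₂) f x := by
      intro x
      have := volterraSol_apply (gaugedOp θ hp hq c₁ c₂) ![0, 1] x
      rwa [← h] at this
    refine ⟨fun x => ?_, fun x => ?_⟩
    · simpa [k0] using congrFun (hs x) 0
    · simpa [k1] using congrFun (hs x) 1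

/-- Multiplication of the first component by a constant. -/
noncomputable def scaleFirst (k : ℂ) (f : ℝ →ᵇ (Fin 2 → ℂ)) : ℝ →ᵇ (Fin 2 → ℂ) :=
  (entryOp 0 0 k + entryOp 1 1 1).compLeftContinuousBounded ℝ f

theorem scaleFirst_apply_zero (k : ℂ) (f : ℝ →ᵇ (Fin 2 → ℂ)) (x : ℝ) :
    scaleFirst k f x 0 = k * f x 0 := by
  simp [scaleFirst, entryOp_apply]

theorem scaleFirst_apply_one (k : ℂ) (f : ℝ →ᵇ (Fin 2 → ℂ)) (x : ℝ) :
    scaleFirst k f x 1 = f x 1 := by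
  simp [scaleFirst, entryOp_apply]

/-- Conjugation by `diag(k, 1)` redistributes `k²` between the off-diagonal entries. In this
direction nothing is divided by `k`, so `k = 0` is included. -/
theorem IsGaugedColumn.scaleFirst {θ : ℝ} {p q : ℝ → ℂ} {k : ℂ} {f : ℝ →ᵇ (Fin 2 → ℂ)}
    (h : IsGaugedColumn θ p q 1 (k ^ 2) f) : IsGaugedColumn θ p q k k (scaleFirst k f) := by
  refine ⟨fun x => ?_, fun x => ?_⟩
  · rw [scaleFirst_apply_zero, h.first x, mul_neg, ← integral_const_mul]
    congr 2 with y
    rw [scaleFirst_apply_zero, scaleFirst_apply_one]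
    ring
  · rw [scaleFirst_apply_one, h.second x]
    congr 2 with y
    rw [scaleFirst_apply_zero, scaleFirst_apply_one]
    ring

theorem IsGaugedColumn.isVolterraColumn {θ : ℝ} {p q : ℝ → ℂ} {k : ℂ} {f : ℝ →ᵇ (Fin 2 → ℂ)}
    (h : IsGaugedColumn θ p q k k f) {W : ℝ → Matrix (Fin 2) (Fin 2) ℂ}
    (hW : ∀ y, W y = !![p y, k * q y; k * conj (q y), -p y]) :
    IsVolterraColumn θ W
      fun x => ![Complex.exp (-(2 * Complex.I * θ * x)) * f x 0, f x 1] := by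
  have hn : ∀ x : ℝ, ‖Complex.exp (-(2 * Complex.I * θ * x))‖ = 1 := by
    intro x
    rw [show -(2 * Complex.I * θ * x) = Complex.I * ((-(2 * θ * x) : ℝ) : ℂ) by push_cast; ring,
      Complex.norm_exp_I_mul_ofReal]
  refine ⟨?_, ?_, fun x hx => ?_, fun x hx => ?_⟩
  · refine Continuous.continuousOn (continuous_pi fun i => ?_)
    fin_cases i
    · exact (by fun_prop : Continuous fun x : ℝ => Complex.exp (-(2 * Complex.I * θ * x))).mul
        ((continuous_apply 0).comp f.continuous)
    · change Continuous fun x => f x 1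
      exact (continuous_apply 1).comp f.continuous
  · refine ⟨‖f‖, fun x _ => (pi_norm_le_iff_of_nonneg (norm_nonneg _)).2 fun i => ?_⟩
    have hf : ∀ i, ‖f x i‖ ≤ ‖f‖ := fun i => (norm_le_pi_norm _ i).trans (f.norm_coe_le_norm x)
    fin_cases i
    · simpa [hn] using hf 0
    · simpa using hf 1
  · have := h.first x
    rw [max_eq_left hx] at this
    simp only [Matrix.cons_val_zero]
    rw [this, mul_neg, ← integral_const_mul]
    congr 2 with y
    rw [hW]
    simp only [Matrix.mulVec, dotProduct, Fin.sum_univ_two, Matrix.of_apply, Matrix.cons_val_zero,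
      Matrix.cons_val_one]
    have e : Complex.exp (2 * Complex.I * θ * ((y - x : ℝ) : ℂ))
        = Complex.exp (2 * Complex.I * θ * y) * Complex.exp (-(2 * Complex.I * θ * x)) := by
      rw [← Complex.exp_add]; push_cast; ring_nf
    have e1 : Complex.exp (2 * Complex.I * θ * y) * Complex.exp (-(2 * Complex.I * θ * y)) = 1 := by
      rw [← Complex.exp_add, add_neg_cancel, Complex.exp_zero]
    rw [e]
    linear_combination (-Complex.exp (-(2 * Complex.I * θ * x)) * p y * f y 0) * e1
  · have := h.second x
    rw [max_eq_left hx] at this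
    change f x 1 = _
    rw [this]
    refine congrArg (1 - ·) (setIntegral_congr_fun measurableSet_Ioi fun y _ => ?_)
    simp only [hW]
    simp only [Matrix.mulVec, dotProduct, Fin.sum_univ_two, Matrix.of_apply, Matrix.cons_val_zero,
      Matrix.cons_val_one]
    ring

/-- For real `θ` the factor `e^{2iθx}` has modulus one, so boundedness survives; it equals `1` at `x
= 0`, so the value there is unchanged. This reduces uniqueness to the gauged equation. -/
theorem IsVolterraColumn.exists_isGaugedColumn {θ : ℝ} {p q : ℝ → ℂ} {k : ℂ}
    {W : ℝ → Matrix (Fin 2) (Fin 2) ℂ} {ψ : ℝ → Fin 2 → ℂ} (h : IsVolterraColumn θ W ψ)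
    (hW : ∀ y, W y = !![p y, k * q y; k * conj (q y), -p y]) :
    ∃ f : ℝ →ᵇ (Fin 2 → ℂ), IsGaugedColumn θ p q k k f ∧ f 0 = ψ 0 := by
  obtain ⟨C, hC⟩ := h.bounded
  have hn : ∀ x : ℝ, ‖Complex.exp (2 * Complex.I * θ * x)‖ = 1 := by
    intro x
    rw [show 2 * Complex.I * θ * x = Complex.I * ((2 * θ * x : ℝ) : ℂ) by push_cast; ring,
      Complex.norm_exp_I_mul_ofReal]
  have hc : Continuous fun x : ℝ => ψ (max x 0) :=
    h.continuousOn.comp_continuous (continuous_id.max continuous_const) fun x => le_max_right x 0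
  have hC0 : 0 ≤ C := (norm_nonneg _).trans (hC 0 le_rfl)
  let f : ℝ →ᵇ (Fin 2 → ℂ) := BoundedContinuousFunction.ofNormedAddCommGroup
    (fun x : ℝ => ![Complex.exp (2 * Complex.I * θ * (max x 0 : ℝ)) * ψ (max x 0) 0,
      ψ (max x 0) 1])
    (by
      refine continuous_pi fun i => ?_
      fin_cases i
      · exact (by fun_prop :
          Continuous fun x : ℝ => Complex.exp (2 * Complex.I * θ * (max x 0 : ℝ))).mul
            ((continuous_apply 0).comp hc)
      · change Continuous fun x : ℝ => ψ (max x 0) 1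
        exact continuous_pi_iff.1 hc 1)
    C (by
      intro x
      have hb : ∀ i, ‖ψ (max x 0) i‖ ≤ C := fun i =>
        (norm_le_pi_norm _ i).trans (hC _ (le_max_right x 0))
      refine (pi_norm_le_iff_of_nonneg hC0).2 fun i => ?_
      fin_cases i
      · simpa only [Fin.zero_eta, Matrix.cons_val_zero, norm_mul, hn, one_mul] using hb 0
      · simpa using hb 1)
  have f0 : ∀ x, f x 0 = Complex.exp (2 * Complex.I * θ * (max x 0 : ℝ)) * ψ (max x 0) 0 :=
    fun _ => rfl
  have f1 : ∀ x, f x 1 = ψ (max x 0) 1 := fun _ => rfl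
  refine ⟨f, ⟨fun x => ?_, fun x => ?_⟩, ?_⟩
  · rw [f0, h.first _ (le_max_right x 0), mul_neg, ← integral_const_mul]
    refine congrArg _ (setIntegral_congr_fun measurableSet_Ioi fun y hy => ?_)
    have hy0 : max y 0 = y := max_eq_left ((le_max_right x 0).trans (le_of_lt hy))
    simp only [hW, f0, f1, hy0, Matrix.mulVec, dotProduct, Fin.sum_univ_two, Matrix.of_apply,
      Matrix.cons_val_zero, Matrix.cons_val_one]
    set z := max x 0
    have e : Complex.exp (2 * Complex.I * θ * y) = Complex.exp (2 * Complex.I * θ * z)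
        * Complex.exp (2 * Complex.I * θ * ((y - z : ℝ) : ℂ)) := by
      rw [← Complex.exp_add]; push_cast; ring_nf
    rw [e]
    ring
  · rw [f1, h.second _ (le_max_right x 0)]
    refine congrArg _ (setIntegral_congr_fun measurableSet_Ioi fun y hy => ?_)
    have hy0 : max y 0 = y := max_eq_left ((le_max_right x 0).trans (le_of_lt hy))
    simp only [hW, f0, f1, hy0, Matrix.mulVec, dotProduct, Fin.sum_univ_two, Matrix.of_apply,
      Matrix.cons_val_zero, Matrix.cons_val_one]
    have e1 : Complex.exp (2 * Complex.I * θ * y) * Complex.exp (-(2 * Complex.I * θ * y)) = 1 := by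
      rw [← Complex.exp_add, add_neg_cancel, Complex.exp_zero]
    linear_combination (-k * conj (q y) * ψ y 0) * e1
  · ext i
    fin_cases i
    · simp [f0]
    · simp [f1]

/-- The second column at `0` for the desingularized system, in which the factor `k` has been
removed from the first entry. -/
noncomputable def gaugedSol (θ : ℝ) {p q : ℝ → ℂ} (hp : RapidDecay p) (hq : RapidDecay q)
    (l : ℝ) : ℝ →ᵇ (Fin 2 → ℂ) :=
  volterraSol (gaugedOp θ hp hq 1 l) ![0, 1]

theorem isGaugedColumn_gaugedSol (θ : ℝ) {p q : ℝ → ℂ} (hp : RapidDecay p) (hq : RapidDecay q)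
    (l : ℝ) : IsGaugedColumn θ p q 1 l (gaugedSol θ hp hq l) :=
  (isGaugedColumn_iff θ hp hq 1 l _).2 rfl

/-- The desingularized solution shows that a column exists, so the `epsilon` choice is a genuine
solution; uniqueness of the gauged equation then identifies its value at `0`. -/
theorem volterraValue_eq {θ : ℝ} {p q : ℝ → ℂ} (hp : RapidDecay p) (hq : RapidDecay q)
    {k : ℂ} {l : ℝ} (hk : k ^ 2 = l) {W : ℝ → Matrix (Fin 2) (Fin 2) ℂ}
    (hW : ∀ y, W y = !![p y, k * q y; k * conj (q y), -p y]) :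
    volterraValue θ W = ![k * gaugedSol θ hp hq l 0 0, gaugedSol θ hp hq l 0 1] := by
  have h := isGaugedColumn_gaugedSol θ hp hq l
  rw [← hk] at h
  have hex := h.scaleFirst.isVolterraColumn hW
  have hv : IsVolterraColumn θ W (Classical.epsilon (IsVolterraColumn θ W)) :=
    Classical.epsilon_spec ⟨_, hex⟩
  obtain ⟨f, hf, hf0⟩ := hv.exists_isGaugedColumn hW
  have he : f = scaleFirst k (gaugedSol θ hp hq l) :=
    ((isGaugedColumn_iff θ hp hq k k _).1 hf).trans
      ((isGaugedColumn_iff θ hp hq k k _).1 h.scaleFirst).symm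
  rw [volterraValue, ← hf0, he]
  ext i
  fin_cases i
  · simp [scaleFirst_apply_zero]
  · simp [scaleFirst_apply_one]


/-! ### Spectral functions as smooth functions of real `k²` -/

theorem RapidDecay.weight_mul_osc_add {f g : ℝ → ℂ} (hf : RapidDecay f) (hg : RapidDecay g) {l : ℝ}
    (h : RapidDecay fun x => f x + l * g x) (t : ℝ) :
    h.weight_mul.osc t = hf.weight_mul.osc t + l • hg.weight_mul.osc t := by
  ext y
  simp only [BoundedContinuousFunction.coe_add, BoundedContinuousFunction.coe_smul, Pi.add_apply,
    RapidDecay.osc_apply, Complex.real_smul]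
  ring

theorem RapidDecay.conjugate_weight_mul_osc_add {f g : ℝ → ℂ} (hf : RapidDecay f)
    (hg : RapidDecay g) {l : ℝ} (h : RapidDecay fun x => f x + l * g x) (t : ℝ) :
    h.conjugate.weight_mul.osc t
      = hf.conjugate.weight_mul.osc t + l • hg.conjugate.weight_mul.osc t := by
  ext y
  simp only [BoundedContinuousFunction.coe_add, BoundedContinuousFunction.coe_smul, Pi.add_apply,
    RapidDecay.osc_apply, Complex.real_smul, map_add, map_mul, Complex.conj_ofReal]
  ring

theorem RapidDecay.add_mul {f g : ℝ → ℂ} (hf : RapidDecay f) (hg : RapidDecay g) (l : ℝ) :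
    RapidDecay fun x => f x + l * g x :=
  hf.add (hg.const_mul l)

theorem contDiff_gaugedSol {θ : ℝ → ℝ} (hθ : ContDiff ℝ ∞ θ) {p₀ p₁ q₀ q₁ : ℝ → ℂ}
    (hp₀ : RapidDecay p₀) (hp₁ : RapidDecay p₁) (hq₀ : RapidDecay q₀) (hq₁ : RapidDecay q₁)
    (i : Fin 2) :
    ContDiff ℝ ∞ fun l => gaugedSol (θ l) (hp₀.add_mul hp₁ l) (hq₀.add_mul hq₁ l) l 0 i := by
  have hm : ContDiff ℝ ∞ fun l =>
      gaugedOp (θ l) (hp₀.add_mul hp₁ l) (hq₀.add_mul hq₁ l) 1 l := by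
    refine contDiff_coefficientOp ?_ ?_ ?_
    · simp only [fun l => hp₀.weight_mul_osc_add hp₁ (hp₀.add_mul hp₁ l)]
      exact contDiff_const.add (contDiff_id.smul contDiff_const)
    · simp only [fun l => hq₀.weight_mul_osc_add hq₁ (hq₀.add_mul hq₁ l), one_smul]
      exact (hq₀.weight_mul.contDiff_osc.comp (contDiff_const.mul hθ)).add
        (contDiff_id.smul (hq₁.weight_mul.contDiff_osc.comp (contDiff_const.mul hθ)))
    · have h : ∀ (l : ℝ) (g : ℝ →ᵇ ℂ), (l : ℂ) • g = l • g := by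
        intro l g
        ext y
        simp
      simp only [fun l => hq₀.conjugate_weight_mul_osc_add hq₁ (hq₀.add_mul hq₁ l), h]
      exact contDiff_id.smul
        ((hq₀.conjugate.weight_mul.contDiff_osc.comp (contDiff_const.mul hθ).neg).add
          (contDiff_id.smul (hq₁.conjugate.weight_mul.contDiff_osc.comp
            (contDiff_const.mul hθ).neg)))
  exact contDiff_pi.1 (contDiff_volterraSol hm ![0, 1] 0) i

/-- The form `|f₁|² - l|f₀|²` is constant along the flow, because `p` is imaginary and the lower
off-diagonal entry is `l` times the conjugate of the upper one. At infinity `f` tends to `(0, 1)`.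
-/
theorem gaugedSol_conservation (θ : ℝ) {p q : ℝ → ℂ} (hp : RapidDecay p) (hq : RapidDecay q)
    (himag : ∀ y, conj (p y) = -p y) (l : ℝ) :
    gaugedSol θ hp hq l 0 1 * conj (gaugedSol θ hp hq l 0 1)
      - l * (gaugedSol θ hp hq l 0 0 * conj (gaugedSol θ hp hq l 0 0)) = 1 := by
  set m := gaugedOp θ hp hq 1 l with hm
  set f := gaugedSol θ hp hq l with hf
  set h : ℝ → Fin 2 → ℂ := fun y => (1 + y ^ 2)⁻¹ • m y (f y) with hh
  have hcont : Continuous h := continuous_weight_smul m f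
  have hint : Integrable h := integrable_weight_smul m f
  -- `f` is constant on the negative axis and may have a corner at `0`; `F` agrees with it on `[0,
  -- ∞)` and is differentiable everywhere.
  let F : ℝ → Fin 2 → ℂ := fun x => ![0, 1] - (∫ y in Ioi 0, h y) + ∫ y in (0 : ℝ)..x, h y
  have hFf : ∀ x, 0 ≤ x → F x = f x := by
    intro x hx
    have := volterraSol_apply m ![0, 1] x
    rw [tailIntegral_eq, max_eq_left hx] at this
    rw [hf, gaugedSol, this]
    simp only [F, hh, hf, gaugedSol, hm]
    abel
  have hF : ∀ x, HasDerivAt F (h x) x := fun x =>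
    (hcont.integral_hasStrictDerivAt 0 x).hasDerivAt.const_add _
  have hlim : Tendsto F atTop (𝓝 ![0, 1]) := by
    have := (intervalIntegral_tendsto_integral_Ioi 0 hint.integrableOn tendsto_id).const_add
      (![0, 1] - ∫ y in Ioi 0, h y)
    simpa only [sub_add_cancel, id] using this
  let Q : ℝ → ℂ := fun x => F x 1 * conj (F x 1) - l * (F x 0 * conj (F x 0))
  have hQ : ∀ x, 0 ≤ x → HasDerivAt Q 0 x := by
    intro x hx
    have hc := hasDerivAt_pi.1 (hF x)
    have hc' : ∀ i, HasDerivAt (fun x => conj (F x i)) (conj (h x i)) x := fun i =>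
      (hc i).star
    have hd := ((hc 1).mul (hc' 1)).sub (((hc 0).mul (hc' 0)).const_mul (l : ℂ))
    refine hd.congr_deriv ?_
    have h0 : h x 0 = p x * f x 0 + 1 * Complex.exp (2 * Complex.I * θ * x) * q x * f x 1 :=
      gaugedOp_apply_zero θ hp hq 1 l hx (f x)
    have h1 : h x 1 = l * Complex.exp (-(2 * Complex.I * θ * x)) * conj (q x) * f x 0
        - p x * f x 1 := gaugedOp_apply_one θ hp hq 1 l hx (f x)
    have he : conj (Complex.exp (2 * Complex.I * θ * x))
        = Complex.exp (-(2 * Complex.I * θ * x)) := by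
      rw [← Complex.exp_conj]
      simp [Complex.conj_ofNat]
    have he' : conj (Complex.exp (-(2 * Complex.I * θ * x)))
        = Complex.exp (2 * Complex.I * θ * x) := by
      rw [← he, Complex.conj_conj]
    rw [h0, h1, hFf x hx]
    simp only [map_add, map_sub, map_mul, he, he', himag, Complex.conj_conj, Complex.conj_ofReal,
      map_one]
    ring
  have hconst : ∀ x, 0 ≤ x → Q x = Q 0 := by
    intro x hx
    refine constant_of_has_deriv_right_zero (a := 0) (b := x) (f := Q) ?_ ?_ x ⟨hx, le_rfl⟩
    · exact fun y hy => (hQ y hy.1).continuousAt.continuousWithinAt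
    · exact fun y hy => (hQ y hy.1).hasDerivWithinAt
  have hl : Tendsto Q atTop (𝓝 1) := by
    have hi := tendsto_pi_nhds.1 hlim
    have hi' : ∀ i, Tendsto (fun x => conj (F x i)) atTop (𝓝 (conj (![0, 1] i))) := fun i =>
      (Complex.continuous_conj.tendsto _).comp (hi i)
    have := ((hi 1).mul (hi' 1)).sub (((hi 0).mul (hi' 0)).const_mul (l : ℂ))
    simpa using this
  have hQ0 : Q 0 = 1 :=
    tendsto_nhds_unique (tendsto_const_nhds.congr' ((eventually_ge_atTop 0).mono fun x hx =>
      (hconst x hx).symm)) hl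
  rw [← hFf 0 le_rfl]
  exact hQ0

/-- The spectral functions of a Lax matrix `[[p, k q], [k q̄, -p]]`, with `p`, `q` affine in `k²`,
are smooth functions of real `k²` after division of the first one by `k`. -/
theorem exists_smooth_spectral {θ : ℝ → ℝ} (hθ : ContDiff ℝ ∞ θ) {p₀ p₁ q₀ q₁ : ℝ → ℂ}
    (hp₀ : RapidDecay p₀) (hp₁ : RapidDecay p₁) (hq₀ : RapidDecay q₀) (hq₁ : RapidDecay q₁)
    (h₀ : ∀ y, conj (p₀ y) = -p₀ y) (h₁ : ∀ y, conj (p₁ y) = -p₁ y) :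
    ∃ α β : ℝ → ℂ, ContDiff ℝ ∞ α ∧ ContDiff ℝ ∞ β ∧
      (∀ l : ℝ, α l * conj (α l) - l * (β l * conj (β l)) = 1) ∧
      ∀ (k : ℂ) (l : ℝ) (W : ℝ → Matrix (Fin 2) (Fin 2) ℂ), k ^ 2 = l →
        (∀ y, W y = !![p₀ y + l * p₁ y, k * (q₀ y + l * q₁ y);
          k * conj (q₀ y + l * q₁ y), -(p₀ y + l * p₁ y)]) →
        volterraValue (θ l) W = ![k * β l, α l] := by
  refine ⟨_, _, contDiff_gaugedSol hθ hp₀ hp₁ hq₀ hq₁ 1, contDiff_gaugedSol hθ hp₀ hp₁ hq₀ hq₁ 0,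
    fun l => gaugedSol_conservation _ _ _ (fun y => ?_) l, fun k l W hk hW =>
      volterraValue_eq _ _ hk hW⟩
  simp only [map_add, map_mul, h₀, h₁, Complex.conj_ofReal]
  ring

theorem continuousOn_exp_integral {g : ℝ → ℝ} (hg : ContinuousOn g (Ici 0)) (c : ℂ) :
    ContinuousOn (fun x : ℝ => Complex.exp (c * ((∫ y in (0 : ℝ)..x, g y : ℝ) : ℂ))) (Ici 0) := by
  have h : ContinuousOn (fun x : ℝ => ∫ y in (0 : ℝ)..x, g y) (Ici 0) := by
    -- Values of `g` on the negative axis are arbitrary, so `g` is frozen there before integrating.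
    have hG : Continuous fun y : ℝ => g (max y 0) :=
      hg.comp_continuous (continuous_id.max continuous_const) fun y => le_max_right y 0
    have hc : Continuous fun x : ℝ => ∫ y in (0 : ℝ)..x, g (max y 0) :=
      intervalIntegral.continuous_primitive (fun a b => hG.intervalIntegrable a b) 0
    refine hc.continuousOn.congr fun x hx => ?_
    refine intervalIntegral.integral_congr fun y hy => ?_
    rw [uIcc_of_le hx] at hy
    simp only [max_eq_left hy.1]
  exact Complex.continuous_exp.comp_continuousOn
    (continuousOn_const.mul (Complex.continuous_ofReal.comp_continuousOn h))

theorem norm_exp_neg_two_I_mul (x : ℝ) : ‖Complex.exp (-2 * Complex.I * x)‖ = 1 := by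
  rw [show -2 * Complex.I * (x : ℂ) = Complex.I * ((-2 * x : ℝ) : ℂ) by push_cast; ring,
    Complex.norm_exp_I_mul_ofReal]

theorem conj_exp_neg_two_I_mul (x : ℝ) :
    conj (Complex.exp (-2 * Complex.I * x)) = Complex.exp (2 * Complex.I * x) := by
  rw [← Complex.exp_conj]
  simp [Complex.conj_ofNat]

variable {u₀ g₀ g₁ : ℝ → ℂ}

theorem exists_smooth_initial (hu₀ : IsSchwartzHalfLine u₀) :
    ∃ α β : ℝ → ℂ, ContDiff ℝ ∞ α ∧ ContDiff ℝ ∞ β ∧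
      (∀ l : ℝ, α l * conj (α l) - l * (β l * conj (β l)) = 1) ∧
      ∀ (k : ℂ) (l : ℝ), k ^ 2 = l → specB0 u₀ k = k * β l ∧ specA0 u₀ k = α l := by
  have hu := hu₀.rapidDecay
  have hz : RapidDecay fun _ => 0 := by simpa using hu.const_mul 0
  have hphase : ContinuousOn
      (fun x : ℝ => Complex.exp (-2 * Complex.I * (initialPhase u₀ x : ℂ))) (Ici 0) := by
    have := continuousOn_exp_integral (g := fun y => ‖u₀ y‖ ^ 2)
      (hu.continuousOn.norm.pow 2) (-2 * Complex.I * (1 / 2))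
    refine this.congr fun x _ => ?_
    simp only [initialPhase]
    push_cast
    ring_nf
  have hq := hu.mul_bounded hphase fun x _ => (norm_exp_neg_two_I_mul _).le
  obtain ⟨α, β, hα, hβ, hc, hv⟩ := exists_smooth_spectral (θ := id) contDiff_id
    (hu.norm_sq.const_mul (-(Complex.I / 2))) hz hq hz
    (fun y => by simp [Complex.conj_ofNat]; ring) (fun y => by simp)
  refine ⟨α, β, hα, hβ, hc, fun k l hk => ?_⟩
  have h := hv k l (laxU u₀ k) hk fun y => by
    simp only [laxU, mul_zero, add_zero, map_mul, conj_exp_neg_two_I_mul]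
    ext i j
    fin_cases i <;> fin_cases j <;> simp [mul_assoc]
  rw [specB0, specA0, hk]
  exact ⟨congrFun h 0, congrFun h 1⟩

theorem exists_smooth_boundary (hg₀ : IsSchwartzHalfLine g₀) (hg₁ : IsSchwartzHalfLine g₁) :
    ∃ α β : ℝ → ℂ, ContDiff ℝ ∞ α ∧ ContDiff ℝ ∞ β ∧
      (∀ l : ℝ, α l * conj (α l) - l * (β l * conj (β l)) = 1) ∧
      ∀ (k : ℂ) (l : ℝ), k ^ 2 = l → specB g₀ g₁ k = k * β l ∧ specA g₀ g₁ k = α l := by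
  have h0 := hg₀.rapidDecay
  have h1 := hg₁.rapidDecay
  have hform : ContinuousOn (boundaryForm g₀ g₁) (Ici 0) := by
    refine Complex.continuous_re.comp_continuousOn ?_
    exact ((h0.norm_pow_four.const_mul (3 / 4)).add (((h1.conjugate.mul h0).add
      ((h0.conjugate.mul h1).const_mul (-1))).const_mul
        (-(Complex.I / 2)))).continuousOn.congr fun x _ => by ring
  have hphase := continuousOn_exp_integral hform (-2 * Complex.I)
  have hq₀ := ((h1.const_mul Complex.I).add (h0.norm_sq.mul h0)).mul_bounded hphase
    fun x _ => (norm_exp_neg_two_I_mul _).le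
  have hq₁ := (h0.const_mul 2).mul_bounded hphase fun x _ => (norm_exp_neg_two_I_mul _).le
  have hp₀ := (h0.norm_pow_four.const_mul (-(3 * Complex.I / 4))).add
    (((h1.conjugate.mul h0).add ((h0.conjugate.mul h1).const_mul (-1))).const_mul (-(1 / 2)))
  have hp₁ := h0.norm_sq.const_mul (-Complex.I)
  -- Once `k` is taken out of the off-diagonal entries, only even powers of `k` remain: `V` is
  -- affine in `l`, and the phase `2k⁴` is `2l²`.
  obtain ⟨α, β, hα, hβ, hc, hv⟩ := exists_smooth_spectral (θ := fun l => 2 * l ^ 2)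
    (contDiff_const.mul (contDiff_id.pow 2)) hp₀ hp₁ hq₀ hq₁
    (fun y => by simp [Complex.conj_ofNat]; ring) (fun y => by simp)
  refine ⟨α, β, hα, hβ, hc, fun k l hk => ?_⟩
  have h := hv k l (laxV g₀ g₁ k) hk fun y => by
    have hl : (l : ℂ) = k ^ 2 := hk.symm
    have e := conj_exp_neg_two_I_mul (∫ s in (0 : ℝ)..y, boundaryForm g₀ g₁ s)
    have hlc : conj ((l : ℂ)) = k ^ 2 := by rw [Complex.conj_ofReal, hl]
    simp only [laxV, boundaryPhase, map_add, map_mul, e, hlc]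
    ext i j
    fin_cases i <;> fin_cases j <;> simp [hl, Complex.conj_ofNat] <;> ring
  have e : (2 : ℂ) * k ^ 4 = ((2 * l ^ 2 : ℝ) : ℂ) := by
    rw [show k ^ 4 = (k ^ 2) ^ 2 by ring, hk]
    push_cast
    ring
  rw [specB, specA, e]
  exact ⟨congrFun h 0, congrFun h 1⟩


/-! ### Smooth functions vanishing on one side of a point -/

section Flat

variable {E : Type*} [NormedAddCommGroup E] [NormedSpace ℝ E] {f : ℝ → E}

/-- Each derivative vanishes on the open set and is continuous, hence vanishes on the closure. -/
theorem iteratedDeriv_eq_zero_of_mem_closure (hf : ContDiff ℝ ∞ f) {s : Set ℝ} (hs : IsOpen s)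
    (h : ∀ x ∈ s, f x = 0) {a : ℝ} (ha : a ∈ closure s) (j : ℕ) : iteratedDeriv j f a = 0 := by
  have hc : Continuous (iteratedDeriv j f) :=
    hf.continuous_iteratedDeriv j (by exact_mod_cast le_top)
  have hz : ∀ x ∈ s, iteratedDeriv j f x = 0 := by
    intro x hx
    have he : f =ᶠ[𝓝 x] fun _ => 0 := by
      filter_upwards [hs.mem_nhds hx] with y hy using h y hy
    rw [he.iteratedDeriv_eq]
    simp
  have hcl : IsClosed {x | iteratedDeriv j f x = 0} := isClosed_eq hc continuous_const
  exact closure_minimal (fun x hx => hz x hx) hcl ha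

theorem iteratedDerivWithin_eq_zero_of_mem_closure (hf : ContDiff ℝ ∞ f) {s t : Set ℝ}
    (hs : IsOpen s) (h : ∀ x ∈ s, f x = 0) {a : ℝ} (ha : a ∈ closure s) (ht : UniqueDiffOn ℝ t)
    (hat : a ∈ t) (j : ℕ) : iteratedDerivWithin j f t a = 0 := by
  rw [iteratedDerivWithin_eq_iteratedDeriv ht (hf.of_le (by exact_mod_cast le_top)).contDiffAt hat]
  exact iteratedDeriv_eq_zero_of_mem_closure hf hs h ha j

theorem exists_norm_le_pow_of_eq_zero (hf : ContDiff ℝ ∞ f) (h : ∀ x < 0, f x = 0) (n : ℕ) :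
    ∃ C : ℝ, 0 < C ∧ ∀ x, 0 ≤ x → x ≤ 1 → ‖f x‖ ≤ C * x ^ n := by
  obtain ⟨C, hC⟩ := exists_taylor_mean_remainder_bound (f := f) (a := 0) (b := 1) (n := n)
    zero_le_one (hf.of_le (by exact_mod_cast le_top)).contDiffOn
  refine ⟨max C 1, by positivity, fun x hx0 hx1 => ?_⟩
  -- Flatness at `0` kills the whole Taylor polynomial, so `f` equals its remainder.
  have ht : taylorWithinEval f n (Icc 0 1) 0 x = 0 := by
    rw [taylor_within_apply]
    refine Finset.sum_eq_zero fun k _ => ?_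
    rw [iteratedDerivWithin_eq_zero_of_mem_closure hf isOpen_Iio h (by simp [closure_Iio])
      (uniqueDiffOn_Icc zero_lt_one) (by simp), smul_zero]
  have := hC x ⟨hx0, hx1⟩
  rw [ht, sub_zero, sub_zero] at this
  calc ‖f x‖ ≤ C * x ^ (n + 1) := this
    _ ≤ max C 1 * x ^ n := by
      gcongr ?_ * ?_
      · exact le_max_left _ _
      · exact pow_le_pow_of_le_one hx0 hx1 (Nat.le_succ n)

end Flat

/-! ### The reflection coefficient, `ν` and `u_a` -/

variable {u₀ g₀ g₁ : ℝ → ℂ}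

/-- On `k² = l ∈ ℝ` the spectral functions are `a = α(l)`, `c = k γ(l)`, `d = δ(l)`, and
`r = γ̄ / δ`, with smooth `γ`, `δ`. -/
theorem exists_smooth_reflection (hu₀ : IsSchwartzHalfLine u₀) (hg₀ : IsSchwartzHalfLine g₀)
    (hg₁ : IsSchwartzHalfLine g₁) (ha : ∀ k : ℂ, 0 ≤ (k ^ 2).im → specA0 u₀ k ≠ 0) :
    ∃ γ δ : ℝ → ℂ, ContDiff ℝ ∞ γ ∧ ContDiff ℝ ∞ δ ∧
      (∀ l : ℝ, δ l * conj (δ l) - l * (γ l * conj (γ l)) = 1) ∧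
      (∀ (k : ℂ) (l : ℝ), k ^ 2 = l →
        specC u₀ g₀ g₁ k = k * γ l ∧ specD u₀ g₀ g₁ k = δ l) ∧
      ∀ l < 0, δ l ≠ 0 → specR u₀ g₀ g₁ l = conj (γ l) / δ l := by
  obtain ⟨α, β, hα, hβ, hc, hv⟩ := exists_smooth_initial hu₀
  obtain ⟨α', β', hα', hβ', hc', hv'⟩ := exists_smooth_boundary hg₀ hg₁
  have hconj : ∀ {f : ℝ → ℂ}, ContDiff ℝ ∞ f → ContDiff ℝ ∞ fun l => conj (f l) := fun hf =>
    Complex.conjCLE.contDiff.comp hf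
  have hid : ContDiff ℝ ∞ fun l : ℝ => (l : ℂ) := Complex.ofRealCLM.contDiff
  have hk : ∀ {k : ℂ} {l : ℝ}, k ^ 2 = l → (conj k) ^ 2 = (l : ℂ) := by
    intro k l h
    rw [← map_pow, h, Complex.conj_ofReal]
  have hD : ∀ (k : ℂ) (l : ℝ), k ^ 2 = l →
      specD u₀ g₀ g₁ k = α l * conj (α' l) - l * (β l * conj (β' l)) := by
    intro k l h
    rw [specD, schwarzConj, schwarzConj, (hv k l h).1, (hv k l h).2, (hv' _ l (hk h)).1,
      (hv' _ l (hk h)).2, map_mul, Complex.conj_conj, ← h]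
    ring
  refine ⟨fun l => β l * α' l - β' l * α l, fun l => α l * conj (α' l) - l * (β l * conj (β' l)),
    (hβ.mul hα').sub (hβ'.mul hα), (hα.mul (hconj hα')).sub (hid.mul (hβ.mul (hconj hβ'))),
    fun l => ?_, fun k l h => ⟨?_, hD k l h⟩, fun l hl hδ => ?_⟩
  · simp only [map_sub, map_mul, Complex.conj_conj, Complex.conj_ofReal]
    -- The form is multiplicative: `|δ|² - l|γ|²` is the product of the two conserved quantities.
    linear_combination (α' l * conj (α' l) - l * (β' l * conj (β' l))) * hc l + hc' l
  · rw [specC, (hv k l h).1, (hv k l h).2, (hv' k l h).1, (hv' k l h).2]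
    ring
  · set k : ℂ := (Real.sqrt (-l) : ℂ) * Complex.I with hkdef
    have h : k ^ 2 = l := by
      rw [hkdef, mul_pow, Complex.I_sq, ← Complex.ofReal_pow, Real.sq_sqrt (by linarith)]
      simp
    have hk0 : k ≠ 0 := by
      rintro h0
      rw [h0, zero_pow two_ne_zero] at h
      exact hl.ne (by exact_mod_cast h.symm)
    have ha0 : α l ≠ 0 := by
      rw [← (hv k l h).2]
      exact ha k (by simp [h])
    have hR : specR u₀ g₀ g₁ l = schwarzConj (specB0 u₀) k / (k * specA0 u₀ k)
        - schwarzConj (specB g₀ g₁) k / (k * specA0 u₀ k * specD u₀ g₀ g₁ k) := rfl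
    clear_value k
    beta_reduce at hδ ⊢
    rw [hR, hD k l h, schwarzConj, schwarzConj, (hv _ l (hk h)).1, (hv k l h).2,
      (hv' _ l (hk h)).1, map_mul, map_mul, Complex.conj_conj]
    rw [div_sub_div _ _ (mul_ne_zero hk0 ha0) (mul_ne_zero (mul_ne_zero hk0 ha0) hδ),
      div_eq_div_iff (mul_ne_zero (mul_ne_zero hk0 ha0) (mul_ne_zero (mul_ne_zero hk0 ha0) hδ)) hδ]
    simp only [map_sub, map_mul]
    -- Here `r = (β̄δ - β̄')/(αδ)`, and `1 + l|β|² = |α|²` turns the numerator into `αγ̄`, so `α`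
    -- cancels.
    linear_combination (k * α l * k * (α l * conj (α' l) - l * (β l * conj (β' l)))
      * conj (β' l)) * hc l

theorem norm_sq_spectral {γ δ : ℝ → ℂ}
    (h : ∀ l : ℝ, δ l * conj (δ l) - l * (γ l * conj (γ l)) = 1) (l : ℝ) :
    ‖δ l‖ ^ 2 = 1 + l * ‖γ l‖ ^ 2 := by
  have := h l
  rw [Complex.mul_conj', Complex.mul_conj', sub_eq_iff_eq_add] at this
  exact_mod_cast this

theorem eq_zero_of_globalRelation {γ δ : ℝ → ℂ}
    (h : ∀ (k : ℂ) (l : ℝ), k ^ 2 = l →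
      specC u₀ g₀ g₁ k = k * γ l ∧ specD u₀ g₀ g₁ k = δ l)
    (hG : GlobalRelation u₀ g₀ g₁) {l : ℝ} (hl : 0 < l) : γ l = 0 := by
  have hk : ((Real.sqrt l : ℝ) : ℂ) ^ 2 = l := by
    rw [← Complex.ofReal_pow, Real.sq_sqrt hl.le]
  have h1 := hG (Real.sqrt l : ℝ) (by rw [hk]; exact hl.le) (by rw [hk]; simp)
  have h2 := (h _ l hk).1
  have h3 : ((Real.sqrt l : ℝ) : ℂ) * γ l = 0 := by
    rw [← h2, specC]
    linear_combination -h1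
  have h4 : ((Real.sqrt l : ℝ) : ℂ) ≠ 0 := by exact_mod_cast (Real.sqrt_pos.2 hl).ne'
  exact (mul_eq_zero.1 h3).resolve_left h4

theorem nu_eq {R : ℝ → ℂ} (hR : EqOn R (specR u₀ g₀ g₁) (Iio 0)) {ζ : ℝ} (hζ : 0 ≤ ζ) :
    nu u₀ g₀ g₁ ζ = 1 / (2 * Real.pi) * Real.log (1 + ζ / 4 * ‖R (-(ζ / 4))‖ ^ 2) := by
  rcases hζ.eq_or_lt with rfl | h
  -- At `ζ = 0` the factor `ζ` hides the meaningless value of `specR` at `0`.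
  · simp [nu]
  · rw [nu, hR (show -(ζ / 4) < 0 by linarith), neg_div]
    ring_nf

/-- The argument of the logarithm is at least `1` for `ζ ≥ 0` and equal to `1` for `ζ < 0`, where
`R` vanishes. -/
theorem contDiff_nu_formula {R : ℝ → ℂ} (hR : ContDiff ℝ ∞ R) (h : ∀ l, 0 < l → R l = 0) :
    ContDiff ℝ ∞ fun ζ : ℝ => 1 / (2 * Real.pi) * Real.log (1 + ζ / 4 * ‖R (-(ζ / 4))‖ ^ 2) := by
  have h1 : ContDiff ℝ ∞ fun ζ : ℝ => R (-(ζ / 4)) := hR.comp (contDiff_id.div_const 4).neg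
  refine contDiff_const.mul (ContDiff.log ?_ fun ζ => ?_)
  · exact contDiff_const.add ((contDiff_id.div_const 4).mul (h1.norm_sq ℝ))
  · rcases le_or_gt 0 ζ with hζ | hζ
    · positivity
    · rw [h _ (by linarith)]
      simp

/-- The phase is real and drops out. Then `ln(1+y) ≤ y` produces a factor `|λ₀|` cancelling the one
under the root. -/
theorem norm_uA_le {R : ℝ → ℂ} (hR : EqOn R (specR u₀ g₀ g₁) (Iio 0)) {x t : ℝ} (hx : 0 < x)
    (ht : 0 < t) : ‖uA u₀ g₀ g₁ x t‖ ≤ ‖R (-(x / t / 4))‖ := by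
  have hζ : 0 < x / t := div_pos hx ht
  rw [uA, norm_mul, mul_comm Complex.I, Complex.norm_exp_ofReal_mul_I, mul_one, Complex.norm_real,
    Real.norm_of_nonneg (Real.sqrt_nonneg _), Real.sqrt_le_left (norm_nonneg _), nu_eq hR hζ.le]
  set ζ := x / t
  set ρ := ‖R (-(ζ / 4))‖
  rw [neg_div, abs_neg, abs_of_pos (by positivity : 0 < ζ / 4), div_le_iff₀ (by positivity)]
  have hlog : Real.log (1 + ζ / 4 * ρ ^ 2) ≤ ζ / 4 * ρ ^ 2 := by
    have := Real.log_le_sub_one_of_pos (by positivity : 0 < 1 + ζ / 4 * ρ ^ 2)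
    linarith
  have hpi : 1 / (2 * Real.pi) ≤ 1 := by
    rw [div_le_one (by positivity)]
    linarith [Real.pi_gt_three]
  calc _ ≤ 1 * (ζ / 4 * ρ ^ 2) :=
        mul_le_mul hpi hlog (Real.log_nonneg (by simp; positivity)) zero_le_one
    _ ≤ ρ ^ 2 * (2 * (ζ / 4)) := by nlinarith [mul_nonneg hζ.le (sq_nonneg ρ)]

end DNLS

/-! ### The main theorem -/

theorem mainTheorem2 (u₀ g₀ g₁ : ℝ → ℂ)
    (hu₀ : DNLS.IsSchwartzHalfLine u₀) (hg₀ : DNLS.IsSchwartzHalfLine g₀)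
    (hg₁ : DNLS.IsSchwartzHalfLine g₁)
    -- `a` has no zeros in the closure of `D₁ ∪ D₂`, and `d` none in the closure of `D₂`
    (ha : ∀ k : ℂ, 0 ≤ (k ^ 2).im → DNLS.specA0 u₀ k ≠ 0)
    (hd : ∀ k : ℂ, (k ^ 2).re ≤ 0 → 0 ≤ (k ^ 2).im → DNLS.specD u₀ g₀ g₁ k ≠ 0) :
    (∀ k : ℝ, ‖DNLS.specD u₀ g₀ g₁ (k : ℂ)‖ ^ 2 = 1 + ‖DNLS.specC u₀ g₀ g₁ (k : ℂ)‖ ^ 2) ∧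
    -- `R` is the smooth extension of `r` from `(-∞, 0)` to `(-∞, 0]`
    ∃ R : ℝ → ℂ, ContDiffOn ℝ ∞ R (Iic 0) ∧ EqOn R (DNLS.specR u₀ g₀ g₁) (Iio 0) ∧
      (∀ s : ℝ, ((s : ℂ) * Complex.I) * R (-s ^ 2) =
        DNLS.schwarzConj (DNLS.specC u₀ g₀ g₁) ((s : ℂ) * Complex.I)
          / DNLS.specD u₀ g₀ g₁ ((s : ℂ) * Complex.I)) ∧
      (DNLS.GlobalRelation u₀ g₀ g₁ →
        (∀ j : ℕ, iteratedDerivWithin j R (Iic 0) 0 = 0) ∧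
        (ContDiffOn ℝ ∞ (DNLS.nu u₀ g₀ g₁) (Ici 0) ∧
          ∀ j : ℕ, iteratedDerivWithin j (DNLS.nu u₀ g₀ g₁) (Ici 0) 0 = 0) ∧
        (∀ n : ℕ, ∃ C δ : ℝ, 0 < C ∧ 0 < δ ∧ ∀ x t : ℝ, 0 < x → 0 < t → x / t < δ →
          ‖DNLS.uA u₀ g₀ g₁ x t‖ ≤ C * |x / t| ^ n)) := by
  obtain ⟨γ, δ, hγ, hδ, hcons, hv, hr⟩ := DNLS.exists_smooth_reflection hu₀ hg₀ hg₁ ha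
  have hsq := DNLS.norm_sq_spectral hcons
  have hδ0 : ∀ l, δ l ≠ 0 := by
    intro l h0
    rcases le_or_gt 0 l with hl | hl
    · have := hsq l
      rw [h0, norm_zero] at this
      nlinarith [mul_nonneg hl (sq_nonneg ‖γ l‖)]
    · have hk : ((Real.sqrt (-l) : ℂ) * Complex.I) ^ 2 = l := by
        rw [mul_pow, Complex.I_sq, ← Complex.ofReal_pow, Real.sq_sqrt (by linarith)]
        simp
      refine hd _ ?_ ?_ ((hv _ l hk).2.trans h0)
      · rw [hk]
        exact hl.le
      · rw [hk]
        simp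
  have hR : ContDiff ℝ ∞ fun l => conj (γ l) / δ l := by
    simp only [div_eq_mul_inv]
    exact (Complex.conjCLE.contDiff.comp hγ).mul (hδ.inv hδ0)
  have heq : EqOn (fun l => conj (γ l) / δ l) (DNLS.specR u₀ g₀ g₁) (Iio 0) := fun l hl =>
    (hr l hl (hδ0 l)).symm
  refine ⟨fun k => ?_, fun l => conj (γ l) / δ l, hR.contDiffOn, heq, fun s => ?_, fun hG => ?_⟩
  · obtain ⟨h1, h2⟩ := hv k (k ^ 2) (by push_cast; rfl)
    rw [h1, h2, hsq, norm_mul, mul_pow, Complex.norm_real, Real.norm_eq_abs, sq_abs]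
  · have hk : ((s : ℂ) * Complex.I) ^ 2 = ((-s ^ 2 : ℝ) : ℂ) := by
      rw [mul_pow, Complex.I_sq]
      push_cast
      ring
    have hk' : (conj ((s : ℂ) * Complex.I)) ^ 2 = ((-s ^ 2 : ℝ) : ℂ) := by
      rw [← map_pow, hk, Complex.conj_ofReal]
    rw [DNLS.schwarzConj, (hv _ _ hk').1, (hv _ _ hk).2, map_mul, Complex.conj_conj, mul_div_assoc]
  · have h0 : ∀ l, 0 < l → conj (γ l) / δ l = 0 := by
      intro l hl
      rw [DNLS.eq_zero_of_globalRelation hv hG hl]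
      simp
    have hν := DNLS.contDiff_nu_formula hR h0
    have hνeq : EqOn (DNLS.nu u₀ g₀ g₁) (fun ζ => 1 / (2 * Real.pi) *
        Real.log (1 + ζ / 4 * ‖conj (γ (-(ζ / 4))) / δ (-(ζ / 4))‖ ^ 2)) (Ici 0) :=
      fun ζ hζ => DNLS.nu_eq heq hζ
    refine ⟨fun j => ?_, ⟨?_, fun j => ?_⟩, fun n => ?_⟩
    · exact DNLS.iteratedDerivWithin_eq_zero_of_mem_closure hR isOpen_Ioi h0
        (by simp [closure_Ioi]) (uniqueDiffOn_Iic 0) (by simp) j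
    · exact hν.contDiffOn.congr hνeq
    · rw [iteratedDerivWithin_congr hνeq (mem_Ici.2 (le_refl (0 : ℝ)))]
      -- The formula for `ν` is smooth on `ℝ` and zero for `ζ < 0`, since `λ₀ = -ζ/4` is then
      -- positive.
      refine DNLS.iteratedDerivWithin_eq_zero_of_mem_closure hν (s := Iio 0) isOpen_Iio
        (fun ζ hζ => ?_) (by simp [closure_Iio]) (uniqueDiffOn_Ici 0) (by simp) j
      have hζ' : ζ < 0 := hζ
      simp only [h0 (-(ζ / 4)) (by linarith)]
      simp
    · obtain ⟨C, hC, hb⟩ := DNLS.exists_norm_le_pow_of_eq_zero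
        (f := fun ζ : ℝ => conj (γ (-(ζ / 4))) / δ (-(ζ / 4)))
        (hR.comp (contDiff_id.div_const 4).neg) (fun ζ hζ => h0 _ (by linarith)) n
      refine ⟨C, 1, hC, one_pos, fun x t hx ht hxt => ?_⟩
      rw [abs_of_pos (div_pos hx ht)]
      exact (DNLS.norm_uA_le heq hx ht).trans (hb _ (div_pos hx ht).le hxt.le)
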